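/- Let $q\ge 1$ and let $\mathcal H=\bigoplus_{k=0}^q L^2(\mathbb R^q;\Lambda^k(\mathbb R^q)^*\otimes\mathbb C)$ be the Hilbert space of square integrable (complex-valued) differential forms on $\mathbb R^q$. Let $d$ be the exterior derivative on $\mathcal H$ (the closure of the exterior derivative on smooth compactly supported forms), $d^*$ its adjoint, $D=d+d^*$ the (self-adjoint) Dirac operator and $L=d^*d+dd^*$ the Hodge Laplacian. For $n\ge1$ let $\varphi_n$ be the unique $C^2$ solution on $\mathbb R$ of $$\varphi''(r)+(n-1)\frac{\varphi'(r)}{r}+\varphi(r)=0\quad(r\ne0),\qquad \varphi(0)=1,\quad \varphi'(0)=0,$$ and let $\varphi_n(tD)$, $t\in\mathbb R$, be the bounded operator on $\mathcal H$ given by the functional calculus of $D$. For $t\in\mathbb R$ put $d_t=t\,\varphi_{q+2}(tD)\,d$ on the domain of $d$. Let $f\in\mathcal H$ be in the domain of $d$ with $df$ in the domain of $L$ (for instance, $f$ smooth with compact support). Derivatives in $t$ are taken in the norm of $\mathcal H$. (a) The curve $u(t)=d_tf$ is twice differentiable and has values in the domain of $L$ for $t>0$, where it solves $$u_{tt}+(q-1)\Big[\frac{u_t}{t}-\frac{u}{t^2}\Big]+Lu=0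 .$$ Moreover $u(0)=0$, $u$ is differentiable at $0$ with $u_t(0)=df$, and $\lim_{t\to0}u_t(t)=df$. (b) The curve $u(t)=\varphi_q(tD)\,df$ is twice differentiable and has values in the domain of $L$ for $t>0$, where it solves $$u_{tt}+(q-1)\frac{u_t}{t}+Lu=0 .$$ Moreover $u(0)=df$, $u$ is differentiable at $0$ with $u_t(0)=0$, and $\lim_{t\to0}u_t(t)=0$. -/

import Mathlib

open MeasureTheory Filter Topology
open scoped InnerProductSpace LinearPMap

noncomputable section

/-! ### Spectral measures and the functional calculus of a self-adjoint operator -/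

section Spectral

variable {H : Type*} [NormedAddCommGroup H] [InnerProductSpace ℂ H] [CompleteSpace H]

/-- A projection-valued measure on the Borel sets of `ℝ`, acting on the Hilbert space `H`. -/
structure PVM (H : Type*) [NormedAddCommGroup H] [InnerProductSpace ℂ H] [CompleteSpace H] where
  /-- the projection attached to a set (only the values on Borel sets matter) -/
  proj : Set ℝ → H →L[ℂ] H
  isStarProjection : ∀ B, MeasurableSet B → IsStarProjection (proj B)
  proj_univ : proj Set.univ = 1
  proj_empty : proj ∅ = 0
  proj_inter : ∀ A B, MeasurableSet A → MeasurableSet B → proj (A ∩ B) = proj A * proj B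
  hasSum_proj : ∀ A : ℕ → Set ℝ, (∀ n, MeasurableSet (A n)) → Pairwise (Function.onFun Disjoint A) →
    ∀ x, HasSum (fun n => proj (A n) x) (proj (⋃ n, A n) x)

theorem PVM.norm_sq_eq (E : PVM H) (x : H) {B : Set ℝ} (hB : MeasurableSet B) :
    ‖E.proj B x‖ ^ 2 = (⟪x, E.proj B x⟫_ℂ).re := by
  have h := E.isStarProjection B hB
  have h1 : E.proj B (E.proj B x) = E.proj B x := by
    have := congrArg (fun T : H →L[ℂ] H => T x) h.isIdempotentElem
    simpa using this
  have h2 : ⟪E.proj B x, E.proj B x⟫_ℂ = ⟪x, E.proj B (E.proj B x)⟫_ℂ := by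
    rw [← ContinuousLinearMap.adjoint_inner_right, ← ContinuousLinearMap.star_eq_adjoint,
      h.isSelfAdjoint.star_eq]
  rw [← h1, ← h2, h1]
  simpa using (norm_sq_eq_re_inner (𝕜 := ℂ) (E.proj B x))

/-- The scalar spectral measure `B ↦ ⟪x, E(B) x⟫ = ‖E(B) x‖²` of a vector `x`. -/
def PVM.scalar (E : PVM H) (x : H) : Measure ℝ :=
  Measure.ofMeasurable (fun B _ => ENNReal.ofReal (‖E.proj B x‖ ^ 2))
    (by simp [E.proj_empty])
    (by
      intro A hA hd
      have h : HasSum (fun n => ‖E.proj (A n) x‖ ^ 2) (‖E.proj (⋃ n, A n) x‖ ^ 2) := by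
        simp only [E.norm_sq_eq x (hA _), E.norm_sq_eq x (MeasurableSet.iUnion hA)]
        exact Complex.hasSum_re ((E.hasSum_proj A hA hd x).mapL (innerSL ℂ x))
      rw [← h.tsum_eq, ENNReal.ofReal_tsum_of_nonneg (fun n => by positivity) h.summable])

/-- `A = ∫ s dE(s)`: the domain of `A` consists of the `x` with `∫ s² d⟪x, E x⟫ < ∞`, and
`⟪x, A x⟫ = ∫ s d⟪x, E x⟫` there (which determines `A` by polarization). -/
def PVM.IsResolutionOf (E : PVM H) (A : H →ₗ.[ℂ] H) : Prop :=
  (∀ x, x ∈ A.domain ↔ Integrable (fun s : ℝ => s ^ 2) (E.scalar x)) ∧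
    ∀ x : A.domain, ⟪(x : H), A x⟫_ℂ = ((∫ s, s ∂(E.scalar x) : ℝ) : ℂ)

open Classical in
/-- `∫ g(s) dE(s)` for a bounded Borel function `g`: the bounded operator `T`
with `⟪x, T x⟫ = ∫ g d⟪x, E x⟫` for all `x` (it exists, and is unique by polarization). -/
def PVM.integral (E : PVM H) (g : ℝ → ℝ) : H →L[ℂ] H :=
  if h : ∃ T : H →L[ℂ] H, ∀ x, ⟪x, T x⟫_ℂ = ((∫ s, g s ∂(E.scalar x) : ℝ) : ℂ) then h.choose
  else 0

open Classical in
/-- The functional calculus `g(A) = ∫ g(s) dE(s)` of a self-adjoint operator `A`, for bounded Borel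
functions `g`. By the spectral theorem, `E` exists and is unique if `A` is self-adjoint. -/
def funCalc (A : H →ₗ.[ℂ] H) (g : ℝ → ℝ) : H →L[ℂ] H :=
  if h : ∃ E : PVM H, E.IsResolutionOf A then h.choose.integral g else 0

/-- The product `B A` of two unbounded operators, with its natural domain
`{x ∈ dom A | A x ∈ dom B}`. -/
def opMul (B A : H →ₗ.[ℂ] H) : H →ₗ.[ℂ] H :=
  B.comp (A.domRestrict ((B.domain.comap A.toFun).map A.domain.subtype)) (by
    rintro ⟨x, ⟨y, hy, rfl⟩, hx⟩
    exact hy)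

end Spectral

/-! ### Bessel functions -/

/-- `f'' + (n-1) f'/r + f = 0`, `f(0) = 1`, `f'(0) = 0`, with `f` of class `C²` on the line. -/
structure IsBesselSolution (n : ℕ) (f : ℝ → ℝ) : Prop where
  contDiff : ContDiff ℝ 2 f
  ode : ∀ r : ℝ, r ≠ 0 → deriv (deriv f) r + ((n : ℝ) - 1) * (deriv f r / r) + f r = 0
  init : f 0 = 1
  init_deriv : deriv f 0 = 0

open Classical in
/-- `φ_n`, the unique solution of the initial value problem `IsBesselSolution n` (for `n ≥ 1`). -/
def besselPhi (n : ℕ) : ℝ → ℝ :=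
  if h : ∃ f, IsBesselSolution n f then h.choose else 0

/-! ### Differential forms on `ℝ^q` -/

section Forms

/-- Euclidean space `ℝ^q`. -/
abbrev Rn (q : ℕ) : Type := EuclideanSpace ℝ (Fin q)

/-- Complex-valued alternating `k`-linear forms on `ℝ^q`. -/
abbrev AltForm (q k : ℕ) : Type := Rn q [⋀^Fin k]→L[ℝ] ℂ

/-- The fibre `⊕_k Λ^k (ℝ^q)* ⊗ ℂ`, in the orthonormal basis
`dx_I = dx_{i_1} ∧ ... ∧ dx_{i_k}`, `I = {i_1 < ... < i_k} ⊆ {1, ..., q}`. -/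
abbrev FormFibre (q : ℕ) : Type := EuclideanSpace ℂ (Finset (Fin q))

/-- The Hilbert space of square integrable differential forms of all degrees on `ℝ^q`. -/
abbrev FormSpace (q : ℕ) : Type := Lp (FormFibre q) 2 (volume : Measure (Rn q))

/-- The coordinates `α(e_{i_1}, ..., e_{i_k})`, `I = {i_1 < ... < i_k}`, of a `k`-form `α`
in the basis `dx_I` (the coordinates with `|I| ≠ k` are `0`). -/
def formCoeff {q k : ℕ} (α : AltForm q k) : FormFibre q :=
  WithLp.toLp 2 fun I =>
    if h : I.card = k then α fun i => EuclideanSpace.single (I.orderEmbOfFin h i) (1 : ℝ) else 0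

/-- The graph of the exterior derivative on the smooth compactly supported forms: the span of
the pairs `(ω, dω)`, where `ω` is a smooth compactly supported `k`-form for some `k`. -/
def testGraph (q : ℕ) : Submodule ℂ (FormSpace q × FormSpace q) :=
  Submodule.span ℂ {p | ∃ (k : ℕ) (ω : Rn q → AltForm q k),
    ContDiff ℝ (⊤ : ℕ∞) ω ∧ HasCompactSupport ω ∧
    (p.1 : Rn q → FormFibre q) =ᵐ[volume] (fun x => formCoeff (ω x)) ∧
    (p.2 : Rn q → FormFibre q) =ᵐ[volume] (fun x => formCoeff (extDeriv ω x))}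

/-- The exterior derivative `d` as a closed unbounded operator on the Hilbert space of forms: the
closure of its restriction to the smooth compactly supported forms. -/
def extD (q : ℕ) : FormSpace q →ₗ.[ℂ] FormSpace q :=
  (testGraph q).topologicalClosure.toLinearPMap

/-- The Dirac operator `D = d + d*`. -/
def dirac (q : ℕ) : FormSpace q →ₗ.[ℂ] FormSpace q :=
  extD q + (extD q)†

/-- The Hodge Laplacian `L = d* d + d d*`. -/
def hodgeLaplacian (q : ℕ) : FormSpace q →ₗ.[ℂ] FormSpace q :=
  opMul (extD q)† (extD q) + opMul (extD q) (extD q)†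

/-- `φ_n(t D)`. -/
def phiDirac (q n : ℕ) (t : ℝ) : FormSpace q →L[ℂ] FormSpace q :=
  funCalc (dirac q) fun s => besselPhi n (t * s)

/-- The deformed exterior derivative `d_t = t φ_{q+2}(t D) d`, on the domain of `d`. -/
def deformedExtD (q : ℕ) (t : ℝ) : FormSpace q →ₗ.[ℂ] FormSpace q :=
  (t • phiDirac q (q + 2) t).toLinearMap.compPMap (extD q)

/-- The Bessel acceleration `D_tt u = u_tt + (q-1) (u_t / t - u / t²)`. -/
def besselAccelOne (q : ℕ) (u : ℝ → FormSpace q) (t : ℝ) : FormSpace q :=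
  deriv (deriv u) t + ((q : ℝ) - 1) • ((1 / t) • deriv u t - (1 / t ^ 2) • u t)

/-- The Bessel acceleration `d_tt u = u_tt + (q-1) u_t / t`. -/
def besselAccelZero (q : ℕ) (u : ℝ → FormSpace q) (t : ℝ) : FormSpace q :=
  deriv (deriv u) t + ((q : ℝ) - 1) • ((1 / t) • deriv u t)

/-- `u` solves `a(u) + L u = 0` for `t > 0`, where `a` is a second order acceleration: at every
`t > 0` the curve `u` is twice differentiable in the Hilbert space of forms, `u(t)` lies in the
domain of `L`, and the equation holds. -/
def SolvesWave (q : ℕ) (a : (ℝ → FormSpace q) → ℝ → FormSpace q) (u : ℝ → FormSpace q) : Prop :=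
  ∀ t : ℝ, 0 < t → DifferentiableAt ℝ u t ∧ DifferentiableAt ℝ (deriv u) t ∧
    ∃ h : u t ∈ (hodgeLaplacian q).domain, a u t + hodgeLaplacian q ⟨u t, h⟩ = 0

end Forms

end

/-!
Since `d` is closed and densely defined with `d ∘ d = 0`, von Neumann's theorem on `d* d` and `d d*`
makes `L + 1` surjective, and `D² = L` factors `L + 1` as `(D + i) (D - i)`. So `D` is self-adjoint,
and its spectral measure comes from the continuous functional calculus of the normal resolvent
`R = (D + i)⁻¹`, transported along `s ↦ re (1 / s)`.

In the spectral representation `w(t) = φ_n(t D) v` is the family of functions `s ↦ φ_n(t s)`. The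
energy `φ_n² + φ_n'²` decreases away from `0`, hence `φ_n`, `φ_n'` and `φ_n''` are bounded, and for
`v` in the domain of `D²` dominated convergence lets one differentiate twice under the spectral
integral. The Bessel equation at `r = t s`, multiplied by `t s²`, then says
`t w'' + (n - 1) w' + t D² w = 0`. Part (b) is the case `n = q`, and part (a) is the case
`n = q + 2` rewritten for `u = t w`.
-/

noncomputable section

/-! ### Convergence in `L²` -/

section SquareIntegrable

variable {X F : Type*} [MeasurableSpace X] [NormedAddCommGroup F] {μ ν : Measure X}

theorem eLpNorm_two_sq (f : X → F) (μ : Measure X) : eLpNorm f 2 μ ^ 2 = ∫⁻ s, ‖f s‖ₑ ^ 2 ∂μ := by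
  simpa using eLpNorm_nnreal_pow_eq_lintegral (f := f) (μ := μ) (p := 2) (by norm_num)

theorem memLp_two_ofReal_iff {f : X → ℝ} (hf : Measurable f) :
    MemLp (fun s => (f s : ℂ)) 2 μ ↔ Integrable (fun s => f s ^ 2) μ := by
  have hfc : Measurable fun s => (f s : ℂ) := Complex.measurable_ofReal.comp hf
  simp only [memLp_two_iff_integrable_sq_norm hfc.aestronglyMeasurable, Complex.norm_real,
    Real.norm_eq_abs, sq_abs]

theorem eLpNorm_two_withDensity (μ : Measure X) {g h : X → ℂ} (hg : Measurable g)
    (hh : Measurable h) :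
    eLpNorm g 2 (μ.withDensity fun s => ‖h s‖ₑ ^ 2) = eLpNorm (g * h) 2 μ := by
  refine (ENNReal.pow_right_strictMono two_ne_zero).injective ?_
  simp only [eLpNorm_two_sq, Pi.mul_apply, enorm_mul]
  rw [lintegral_withDensity_eq_lintegral_mul₀
    (hh.enorm.pow_const 2).aemeasurable (hg.enorm.pow_const 2).aemeasurable]
  refine lintegral_congr fun s => ?_
  simp only [Pi.mul_apply]
  ring

theorem memLp_two_add_measure {f : X → F} (hμ : MemLp f 2 μ) (hν : MemLp f 2 ν) :
    MemLp f 2 (μ + ν) := by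
  refine ⟨hμ.1.add_measure hν.1, (ENNReal.pow_lt_top_iff.1 ?_).resolve_right two_ne_zero⟩
  rw [eLpNorm_two_sq, lintegral_add_measure, ← eLpNorm_two_sq, ← eLpNorm_two_sq]
  exact ENNReal.add_lt_top.2 ⟨ENNReal.pow_lt_top hμ.2, ENNReal.pow_lt_top hν.2⟩

theorem tendsto_eLpNorm_mono_measure {ι : Type*} {l : Filter ι} {p : ENNReal} (h : ν ≤ μ)
    {f : ι → X → F} (hf : Tendsto (fun i => eLpNorm (f i) p μ) l (𝓝 0)) :
    Tendsto (fun i => eLpNorm (f i) p ν) l (𝓝 0) :=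
  tendsto_of_tendsto_of_tendsto_of_le_of_le tendsto_const_nhds hf (fun _ => zero_le)
    fun i => eLpNorm_mono_measure (f i) h

theorem tendsto_eLpNorm_two_zero_iff {ι : Type*} {l : Filter ι} {f : ι → X → F} :
    Tendsto (fun i => eLpNorm (f i) 2 μ) l (𝓝 0) ↔
      Tendsto (fun i => ∫⁻ s, ‖f i s‖ₑ ^ 2 ∂μ) l (𝓝 0) := by
  simp only [← eLpNorm_two_sq]
  refine ⟨fun h => by simpa using ENNReal.Tendsto.pow (n := 2) h, fun h => ?_⟩
  have hroot := h.ennrpow_const (1 / 2 : ℝ)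
  rw [ENNReal.zero_rpow_of_pos (by norm_num)] at hroot
  refine hroot.congr fun i => ?_
  rw [← ENNReal.rpow_natCast, ← ENNReal.rpow_mul]
  norm_num

theorem tendsto_eLpNorm_two_sub_of_dominated {ι : Type*} {l : Filter ι} [l.IsCountablyGenerated]
    {G : ι → X → F} {g b : X → F} (hb : MemLp b 2 μ) (hG : ∀ i, AEStronglyMeasurable (G i) μ)
    (hg : AEStronglyMeasurable g μ) (hGb : ∀ i s, ‖G i s‖ ≤ ‖b s‖)
    (hl : ∀ s, Tendsto (fun i => G i s) l (𝓝 (g s))) :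
    Tendsto (fun i => eLpNorm (G i - g) 2 μ) l (𝓝 0) := by
  rcases l.eq_or_neBot with rfl | _
  · exact tendsto_bot
  have hgb : ∀ s, ‖g s‖ ≤ ‖b s‖ := fun s =>
    le_of_tendsto (hl s).norm (.of_forall fun i => hGb i s)
  rw [tendsto_eLpNorm_two_zero_iff, ← lintegral_zero (μ := μ)]
  refine tendsto_lintegral_filter_of_dominated_convergence' (fun s => (2 * ‖b s‖ₑ) ^ 2)
    (.of_forall fun i => ?_) (.of_forall fun i => .of_forall fun s => ?_) ?_
    (.of_forall fun s => ?_)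
  · exact ((hG i).sub hg).enorm.pow_const 2
  · have h := (enorm_sub_le (a := G i s) (b := g s)).trans
      (add_le_add (enorm_le_iff_norm_le.2 (hGb i s)) (enorm_le_iff_norm_le.2 (hgb s)))
    rw [← two_mul] at h
    gcongr
    exact h
  · simp only [mul_pow]
    rw [lintegral_const_mul' _ _ (by simp), ← eLpNorm_two_sq]
    exact ENNReal.mul_ne_top (by simp) (ENNReal.pow_ne_top hb.2.ne)
  · simpa using ENNReal.Tendsto.pow (n := 2) ((hl s).sub_const (g s)).enorm

end SquareIntegrable

/-! ### Isometric extension of a representation by bounded functions -/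

/-- A representation `op` of an algebra of bounded measurable functions on `X` by bounded operators
on `H`, together with finite measures `meas x` such that `‖op a x‖` is the norm of the function
of `a` in `L²(meas x)`. The functions are assumed to be dense in all `L²`-spaces of finite
measures. It covers both the step functions of a projection-valued measure and the continuous
functions on the spectrum of a normal operator. -/
structure SpectralRep (𝒜 X H : Type*) [AddCommGroup 𝒜] [Module ℂ 𝒜] [MeasurableSpace X]
    [NormedAddCommGroup H] [InnerProductSpace ℂ H] where
  /-- the function attached to an element of the algebra -/
  ev : 𝒜 →ₗ[ℂ] (X → ℂ)
  /-- the operator attached to an element of the algebra -/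
  op : 𝒜 →ₗ[ℂ] (H →L[ℂ] H)
  /-- the spectral measure of a vector -/
  meas : H → Measure X
  finite_meas : ∀ x, IsFiniteMeasure (meas x)
  measurable_ev : ∀ a, Measurable (ev a)
  bounded_ev : ∀ a, ∃ C : ℝ, ∀ s, ‖ev a s‖ ≤ C
  norm_op_sq : ∀ a x, ‖op a x‖ ^ 2 = ∫ s, ‖ev a s‖ ^ 2 ∂(meas x)
  exists_mul : ∀ a b, ∃ c, ev c = ev a * ev b ∧ op c = op a * op b
  exists_one : ∃ e, ev e = 1 ∧ op e = 1
  exists_approx : ∀ (ν : Measure X) [IsFiniteMeasure ν] (g : X → ℂ), MemLp g 2 ν →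
    ∀ ε : ENNReal, ε ≠ 0 → ∃ a, eLpNorm (g - ev a) 2 ν ≤ ε

namespace SpectralRep

variable {𝒜 X H : Type*} [AddCommGroup 𝒜] [Module ℂ 𝒜] [MeasurableSpace X]
  [NormedAddCommGroup H] [InnerProductSpace ℂ H] (S : SpectralRep 𝒜 X H)

instance (x : H) : IsFiniteMeasure (S.meas x) := S.finite_meas x

theorem memLp_ev (a : 𝒜) (ν : Measure X) [IsFiniteMeasure ν] : MemLp (S.ev a) 2 ν := by
  obtain ⟨C, hC⟩ := S.bounded_ev a
  exact MemLp.of_bound (S.measurable_ev a).aestronglyMeasurable C (.of_forall hC)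

theorem enorm_op (a : 𝒜) (x : H) : ‖S.op a x‖ₑ = eLpNorm (S.ev a) 2 (S.meas x) := by
  refine (ENNReal.pow_right_strictMono two_ne_zero).injective ?_
  simp only [eLpNorm_two_sq, ← ofReal_norm, ← ENNReal.ofReal_pow (norm_nonneg _), S.norm_op_sq]
  exact ofReal_integral_eq_lintegral_ofReal
    ((S.memLp_ev a _).integrable_norm_pow two_ne_zero) (.of_forall fun s => by positivity)

theorem exists_seq (ν : Measure X) [IsFiniteMeasure ν] {g : X → ℂ} (hg : MemLp g 2 ν) :
    ∃ a : ℕ → 𝒜, Tendsto (fun n => eLpNorm (S.ev (a n) - g) 2 ν) atTop (𝓝 0) := by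
  have happrox : ∀ n : ℕ, ∃ a, eLpNorm (g - S.ev a) 2 ν ≤ (n : ENNReal)⁻¹ := fun n =>
    S.exists_approx ν g hg _ (by simp)
  choose a ha using happrox
  refine ⟨a, tendsto_of_tendsto_of_tendsto_of_le_of_le tendsto_const_nhds
    ENNReal.tendsto_inv_nat_nhds_zero (fun _ => zero_le) fun n => ?_⟩
  rw [eLpNorm_sub_comm]
  exact ha n

/-- The element of `L²(meas x)` defined by an element of the algebra. -/
def toL2 (x : H) : 𝒜 →ₗ[ℂ] Lp ℂ 2 (S.meas x) where
  toFun a := (S.memLp_ev a _).toLp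
  map_add' a b := by
    rw [← MemLp.toLp_add]
    exact MemLp.toLp_congr _ _ (by rw [map_add])
  map_smul' c a := by
    rw [RingHom.id_apply, ← MemLp.toLp_const_smul]
    exact MemLp.toLp_congr _ _ (by rw [map_smul])

theorem denseRange_toL2 (x : H) : DenseRange (S.toL2 x) := by
  intro g
  obtain ⟨a, ha⟩ := S.exists_seq (S.meas x) (Lp.memLp g)
  refine mem_closure_of_tendsto (b := atTop) (f := fun n => S.toL2 x (a n)) ?_
    (.of_forall fun n => Set.mem_range_self _)
  rw [tendsto_iff_edist_tendsto_0, ← Lp.toLp_coeFn g (Lp.memLp g)]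
  simpa only [toL2, LinearMap.coe_mk, AddHom.coe_mk, Lp.edist_toLp_toLp] using ha

/-- The evaluation of the operators at a vector. -/
def opAt (x : H) : 𝒜 →ₗ[ℂ] H :=
  (ContinuousLinearMap.apply ℂ H x).toLinearMap ∘ₗ S.op

theorem norm_opAt (x : H) (a : 𝒜) : ‖S.opAt x a‖ = ‖S.toL2 x a‖ := by
  have h : ‖S.opAt x a‖ₑ = ‖S.toL2 x a‖ₑ :=
    (S.enorm_op a x).trans (Lp.enorm_toLp (S.memLp_ev a _)).symm
  simpa using congrArg ENNReal.toReal h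

variable {S}

theorem memLp_ev_mul {ν : Measure X} (a : 𝒜) {h : X → ℂ} (hh : MemLp h 2 ν) :
    MemLp (S.ev a * h) 2 ν := by
  obtain ⟨C, hC⟩ := S.bounded_ev a
  refine MemLp.of_le_mul (c := C) hh
    ((S.measurable_ev a).aestronglyMeasurable.mul hh.1) (.of_forall fun s => ?_)
  simpa using mul_le_mul_of_nonneg_right (hC s) (norm_nonneg (h s))

theorem tendsto_eLpNorm_ev_mul_sub {ν : Measure X} (a : 𝒜) {f : ℕ → X → ℂ} {g : X → ℂ}
    (h : Tendsto (fun n => eLpNorm (f n - g) 2 ν) atTop (𝓝 0)) :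
    Tendsto (fun n => eLpNorm (S.ev a * f n - S.ev a * g) 2 ν) atTop (𝓝 0) := by
  obtain ⟨C, hC⟩ := S.bounded_ev a
  have hmul : Tendsto (fun n => ENNReal.ofReal C * eLpNorm (f n - g) 2 ν) atTop (𝓝 0) := by
    simpa using ENNReal.Tendsto.const_mul h (Or.inr ENNReal.ofReal_ne_top)
  refine tendsto_of_tendsto_of_tendsto_of_le_of_le tendsto_const_nhds hmul (fun _ => zero_le)
    fun n => ?_
  rw [← mul_sub]
  refine eLpNorm_le_mul_eLpNorm_of_ae_le_mul (.of_forall fun s => ?_) 2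
  simpa using mul_le_mul_of_nonneg_right (hC s) (norm_nonneg _)

theorem tendsto_eLpNorm_ev {ν : Measure X} [IsFiniteMeasure ν] {a : ℕ → 𝒜} {g : X → ℂ}
    (hg : MemLp g 2 ν) (h : Tendsto (fun n => eLpNorm (S.ev (a n) - g) 2 ν) atTop (𝓝 0)) :
    Tendsto (fun n => eLpNorm (S.ev (a n)) 2 ν) atTop (𝓝 (eLpNorm g 2 ν)) := by
  have hLp : Tendsto (fun n => (S.memLp_ev (a n) ν).toLp) atTop (𝓝 hg.toLp) := by
    rw [tendsto_iff_edist_tendsto_0]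
    simpa only [Lp.edist_toLp_toLp] using h
  simpa only [Lp.enorm_toLp] using hLp.enorm

theorem measure_ext {ν ν' : Measure X} [IsFiniteMeasure ν] [IsFiniteMeasure ν']
    (h : ∀ a, eLpNorm (S.ev a) 2 ν = eLpNorm (S.ev a) 2 ν') : ν = ν' := by
  ext B hB
  have hmem : ∀ (ρ : Measure X) [IsFiniteMeasure ρ], MemLp (B.indicator fun _ => (1 : ℂ)) 2 ρ :=
    fun ρ _ => (memLp_const (1 : ℂ)).indicator hB
  obtain ⟨a, ha⟩ := S.exists_seq (ν + ν') (hmem _)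
  have hν := tendsto_eLpNorm_ev (hmem ν) (tendsto_eLpNorm_mono_measure
    (Measure.le_add_right le_rfl) ha)
  have hν' := tendsto_eLpNorm_ev (hmem ν') (tendsto_eLpNorm_mono_measure
    (Measure.le_add_left le_rfl) ha)
  simp only [h] at hν
  have heq := tendsto_nhds_unique hν hν'
  simp only [eLpNorm_indicator_const hB two_ne_zero ENNReal.ofNat_ne_top, enorm_one, one_mul] at heq
  exact (ENNReal.strictMono_rpow_of_pos (by norm_num)).injective heq

variable [CompleteSpace H]

theorem extendOfNorm_opAt_toL2 (x : H) (a : 𝒜) :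
    (S.opAt x).extendOfNorm (S.toL2 x) (S.toL2 x a) = S.op a x :=
  LinearMap.extendOfNorm_eq (S.denseRange_toL2 x)
    ⟨1, fun a => by rw [one_mul, S.norm_opAt]⟩ a

variable (S) in
/-- The isometric extension of `a ↦ op a x` to `L²(meas x)`. -/
def iso (x : H) : Lp ℂ 2 (S.meas x) →ₗᵢ[ℂ] H where
  toLinearMap := ((S.opAt x).extendOfNorm (S.toL2 x)).toLinearMap
  norm_map' g := by
    refine (S.denseRange_toL2 x).induction_on (p := fun g =>
      ‖(S.opAt x).extendOfNorm (S.toL2 x) g‖ = ‖g‖) g ?_ fun a => ?_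
    · exact isClosed_eq (by fun_prop) (by fun_prop)
    · rw [extendOfNorm_opAt_toL2, ← S.norm_opAt]
      rfl

variable (S) in
open Classical in
/-- The vector `g(A) x` for `g` in `L²(meas x)`, where `A` is the operator represented by `S`;
it is `0` if `g` is not in `L²(meas x)`. -/
def vec (x : H) (g : X → ℂ) : H :=
  if h : MemLp g 2 (S.meas x) then S.iso x h.toLp else 0

theorem vec_eq {x : H} {g : X → ℂ} (h : MemLp g 2 (S.meas x)) : S.vec x g = S.iso x h.toLp :=
  dif_pos h

theorem vec_ev (x : H) (a : 𝒜) : S.vec x (S.ev a) = S.op a x :=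
  (vec_eq (S.memLp_ev a _)).trans (extendOfNorm_opAt_toL2 x a)

theorem vec_one (x : H) : S.vec x 1 = x := by
  obtain ⟨e, he, he'⟩ := S.exists_one
  rw [← he, vec_ev, he', one_apply_eq_self]

theorem enorm_vec {x : H} {g : X → ℂ} (h : MemLp g 2 (S.meas x)) :
    ‖S.vec x g‖ₑ = eLpNorm g 2 (S.meas x) := by
  rw [vec_eq h, ← Lp.enorm_toLp h]
  exact (S.iso x).enorm_map _

theorem vec_congr {x : H} {g h : X → ℂ} (e : g =ᵐ[S.meas x] h) : S.vec x g = S.vec x h := by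
  by_cases hg : MemLp g 2 (S.meas x)
  · have hh := (memLp_congr_ae e).1 hg
    rw [vec_eq hg, vec_eq hh, MemLp.toLp_congr hg hh e]
  · rw [vec, vec, dif_neg hg, dif_neg (mt (memLp_congr_ae e).2 hg)]

theorem vec_add {x : H} {g h : X → ℂ} (hg : MemLp g 2 (S.meas x)) (hh : MemLp h 2 (S.meas x)) :
    S.vec x (g + h) = S.vec x g + S.vec x h := by
  rw [vec_eq hg, vec_eq hh, vec_eq (hg.add hh), MemLp.toLp_add, map_add]

theorem vec_sub {x : H} {g h : X → ℂ} (hg : MemLp g 2 (S.meas x)) (hh : MemLp h 2 (S.meas x)) :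
    S.vec x (g - h) = S.vec x g - S.vec x h := by
  rw [vec_eq hg, vec_eq hh, vec_eq (hg.sub hh), MemLp.toLp_sub, map_sub]

theorem vec_const_smul {x : H} {g : X → ℂ} (c : ℂ) (hg : MemLp g 2 (S.meas x)) :
    S.vec x (c • g) = c • S.vec x g := by
  rw [vec_eq hg, vec_eq (hg.const_smul c), MemLp.toLp_const_smul, map_smul]

theorem vec_zero (x : H) : S.vec x 0 = 0 := by
  rw [vec_eq MemLp.zero, MemLp.toLp_zero, map_zero]

theorem inner_vec {x : H} {g h : X → ℂ} (hg : MemLp g 2 (S.meas x)) (hh : MemLp h 2 (S.meas x)) :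
    ⟪S.vec x g, S.vec x h⟫_ℂ = ∫ s, (starRingEnd ℂ) (g s) * h s ∂(S.meas x) := by
  rw [vec_eq hg, vec_eq hh, LinearIsometry.inner_map_map, L2.inner_def]
  refine integral_congr_ae ?_
  filter_upwards [hg.coeFn_toLp, hh.coeFn_toLp] with s hgs hhs
  rw [hgs, hhs, RCLike.inner_apply, mul_comm]

theorem inner_self_vec {x : H} {g : X → ℂ} (hg : MemLp g 2 (S.meas x)) :
    ⟪x, S.vec x g⟫_ℂ = ∫ s, g s ∂(S.meas x) := by
  simpa [vec_one] using inner_vec (g := 1) (memLp_const 1) hg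

theorem tendsto_vec {ι : Type*} {l : Filter ι} {x : H} {g : ι → X → ℂ} {h : X → ℂ}
    (hg : ∀ n, MemLp (g n) 2 (S.meas x)) (hh : MemLp h 2 (S.meas x))
    (ht : Tendsto (fun n => eLpNorm (g n - h) 2 (S.meas x)) l (𝓝 0)) :
    Tendsto (fun n => S.vec x (g n)) l (𝓝 (S.vec x h)) := by
  rw [tendsto_iff_edist_tendsto_0]
  refine ht.congr fun n => ?_
  rw [edist_eq_enorm_sub, ← vec_sub (hg n) hh, enorm_vec ((hg n).sub hh)]

theorem tendsto_vec_of_dominated {ι : Type*} {l : Filter ι} [l.IsCountablyGenerated] [l.NeBot]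
    {x : H} {G : ι → X → ℂ} {g b : X → ℂ} (hb : MemLp b 2 (S.meas x))
    (hG : ∀ i, Measurable (G i)) (hg : Measurable g) (hGb : ∀ i s, ‖G i s‖ ≤ ‖b s‖)
    (hl : ∀ s, Tendsto (fun i => G i s) l (𝓝 (g s))) :
    Tendsto (fun i => S.vec x (G i)) l (𝓝 (S.vec x g)) := by
  have hgb : ∀ s, ‖g s‖ ≤ ‖b s‖ := fun s =>
    le_of_tendsto (hl s).norm (.of_forall fun i => hGb i s)
  exact tendsto_vec (fun i => hb.mono (hG i).aestronglyMeasurable (.of_forall (hGb i)))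
    (hb.mono hg.aestronglyMeasurable (.of_forall hgb))
    (tendsto_eLpNorm_two_sub_of_dominated hb (fun i => (hG i).aestronglyMeasurable)
      hg.aestronglyMeasurable hGb hl)

theorem tendsto_op {x : H} {a : ℕ → 𝒜} {h : X → ℂ} (hh : MemLp h 2 (S.meas x))
    (ht : Tendsto (fun n => eLpNorm (S.ev (a n) - h) 2 (S.meas x)) atTop (𝓝 0)) :
    Tendsto (fun n => S.op (a n) x) atTop (𝓝 (S.vec x h)) := by
  simpa only [vec_ev] using tendsto_vec (fun n => S.memLp_ev (a n) (S.meas x)) hh ht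

theorem op_op_apply (a b : 𝒜) (x : H) : S.op a (S.op b x) = S.vec x (S.ev a * S.ev b) := by
  obtain ⟨c, hc, hc'⟩ := S.exists_mul a b
  rw [← hc, vec_ev, hc', mul_apply_eq_comp]

theorem op_vec {x : H} (a : 𝒜) {h : X → ℂ} (hh : MemLp h 2 (S.meas x)) :
    S.op a (S.vec x h) = S.vec x (S.ev a * h) := by
  obtain ⟨b, hb⟩ := S.exists_seq (S.meas x) hh
  have hlim : Tendsto (fun n => S.op a (S.op (b n) x)) atTop (𝓝 (S.op a (S.vec x h))) :=
    ((S.op a).continuous.tendsto _).comp (tendsto_op hh hb)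
  simp only [op_op_apply] at hlim
  exact tendsto_nhds_unique hlim (tendsto_vec (fun n => memLp_ev_mul a (S.memLp_ev _ _))
    (memLp_ev_mul a hh) (tendsto_eLpNorm_ev_mul_sub a hb))

theorem meas_vec {x : H} {h : X → ℂ} (hm : Measurable h) (hh : MemLp h 2 (S.meas x)) :
    S.meas (S.vec x h) = (S.meas x).withDensity fun s => ‖h s‖ₑ ^ 2 := by
  have : IsFiniteMeasure ((S.meas x).withDensity fun s => ‖h s‖ₑ ^ 2) := by
    refine isFiniteMeasure_withDensity ?_
    rw [← eLpNorm_two_sq]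
    exact ENNReal.pow_ne_top hh.2.ne
  refine S.measure_ext fun a => ?_
  rw [← S.enorm_op, op_vec a hh, enorm_vec (memLp_ev_mul a hh),
    eLpNorm_two_withDensity _ (S.measurable_ev a) hm]

theorem memLp_vec_iff {x : H} {g h : X → ℂ} (hg : Measurable g) (hm : Measurable h)
    (hh : MemLp h 2 (S.meas x)) :
    MemLp g 2 (S.meas (S.vec x h)) ↔ MemLp (g * h) 2 (S.meas x) := by
  rw [meas_vec hm hh, MemLp, MemLp, eLpNorm_two_withDensity _ hg hm,
    and_iff_right hg.aestronglyMeasurable, and_iff_right (hg.mul hm).aestronglyMeasurable]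

theorem vec_vec {x : H} {g h : X → ℂ} (hg : Measurable g) (hm : Measurable h)
    (hh : MemLp h 2 (S.meas x)) (hgh : MemLp (g * h) 2 (S.meas x)) :
    S.vec (S.vec x h) g = S.vec x (g * h) := by
  have hg' := (memLp_vec_iff hg hm hh).2 hgh
  obtain ⟨a, ha⟩ := S.exists_seq (S.meas (S.vec x h)) hg'
  have hlim := tendsto_op hg' ha
  simp only [op_vec _ hh] at hlim
  refine tendsto_nhds_unique hlim (tendsto_vec (fun n => memLp_ev_mul _ hh) hgh
    (ha.congr fun n => ?_))
  rw [← sub_mul, meas_vec hm hh, eLpNorm_two_withDensity _ ((S.measurable_ev _).sub hg) hm]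

theorem vec_add_left {x y : H} {g : X → ℂ} (hx : MemLp g 2 (S.meas x)) (hy : MemLp g 2 (S.meas y))
    (hxy : MemLp g 2 (S.meas (x + y))) : S.vec (x + y) g = S.vec x g + S.vec y g := by
  obtain ⟨a, ha⟩ := S.exists_seq (S.meas x + S.meas y + S.meas (x + y))
    (memLp_two_add_measure (memLp_two_add_measure hx hy) hxy)
  have hlimx := tendsto_op hx (tendsto_eLpNorm_mono_measure
    (Measure.le_add_right (Measure.le_add_right le_rfl)) ha)
  have hlimy := tendsto_op hy (tendsto_eLpNorm_mono_measure
    (Measure.le_add_right (Measure.le_add_left le_rfl)) ha)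
  have hlim := tendsto_op hxy (tendsto_eLpNorm_mono_measure (Measure.le_add_left le_rfl) ha)
  simp only [map_add] at hlim
  exact tendsto_nhds_unique hlim (hlimx.add hlimy)

theorem vec_smul_left {x : H} {g : X → ℂ} (c : ℂ) (hg : Measurable g)
    (hx : MemLp g 2 (S.meas x)) : S.vec (c • x) g = c • S.vec x g := by
  have hc : MemLp (c • (1 : X → ℂ)) 2 (S.meas x) := memLp_const (c • (1 : ℂ))
  have hcx : S.vec x (c • (1 : X → ℂ)) = c • x := by
    rw [vec_const_smul (g := 1) c (memLp_const (1 : ℂ)), vec_one]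
  have hgc : g * (c • (1 : X → ℂ)) = c • g := by
    rw [mul_smul_comm, mul_one]
  rw [← hcx, vec_vec hg (measurable_one.const_smul c) hc (hgc ▸ hx.const_smul c), hgc,
    vec_const_smul c hx]

theorem norm_vec_le {g : X → ℂ} (hg : Measurable g) {C : ℝ} (hC₀ : 0 ≤ C)
    (hC : ∀ s, ‖g s‖ ≤ C) (x : H) : ‖S.vec x g‖ ≤ C * ‖x‖ := by
  have hone : MemLp (1 : X → ℂ) 2 (S.meas x) := memLp_const 1
  have hle := eLpNorm_le_mul_eLpNorm_of_ae_le_mul (μ := S.meas x) (f := g) (g := (1 : X → ℂ))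
    (c := C) (.of_forall fun s => by simpa using hC s) 2
  rw [← enorm_vec (.of_bound hg.aestronglyMeasurable C (.of_forall hC)), ← enorm_vec hone, vec_one,
    ← ofReal_norm, ← ofReal_norm, ← ENNReal.ofReal_mul' (norm_nonneg _)] at hle
  exact (ENNReal.ofReal_le_ofReal_iff (by positivity)).1 hle

/-- The bounded operator `g(A)`, for a bounded measurable function `g`. -/
def fn (S : SpectralRep 𝒜 X H) (g : X → ℂ) (hg : Measurable g) (hC : ∃ C, ∀ s, ‖g s‖ ≤ C) :
    H →L[ℂ] H :=
  have hmem : ∀ x, MemLp g 2 (S.meas x) := fun _ =>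
    hC.elim fun C hC => .of_bound hg.aestronglyMeasurable C (.of_forall hC)
  LinearMap.mkContinuousOfExistsBound
    { toFun := (S.vec · g)
      map_add' := fun x y => vec_add_left (hmem x) (hmem y) (hmem (x + y))
      map_smul' := fun c x => vec_smul_left c hg (hmem x) }
    (hC.elim fun C hC =>
      ⟨max C 0, norm_vec_le hg (le_max_right C 0) fun s => (hC s).trans (le_max_left C 0)⟩)

theorem fn_apply (g : X → ℂ) (hg : Measurable g) (hC : ∃ C, ∀ s, ‖g s‖ ≤ C) (x : H) :
    S.fn g hg hC x = S.vec x g := rfl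

end SpectralRep

/-! ### Integration with respect to a projection-valued measure -/

section PVMIntegration

variable {H : Type*} [NormedAddCommGroup H] [InnerProductSpace ℂ H]

theorem eq_zero_of_inner_self_eq_zero {p : Submodule ℂ H} (hp : Dense (p : Set H))
    {T : p →ₗ[ℂ] H} (hT : ∀ x : p, ⟪(x : H), T x⟫_ℂ = 0) : T = 0 := by
  ext x
  refine hp.eq_zero_of_inner_right (𝕜 := ℂ) fun y hy => ?_
  have hadd := hT (x + ⟨y, hy⟩)
  have hadd_I := hT (x + Complex.I • ⟨y, hy⟩)
  simp only [map_add, map_smul, Submodule.coe_add, Submodule.coe_smul, inner_add_left,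
    inner_add_right, inner_smul_left, inner_smul_right, Complex.conj_I, hT x, hT ⟨y, hy⟩]
    at hadd hadd_I
  linear_combination (1 / 2 : ℂ) * hadd + (Complex.I / 2) * hadd_I +
    (⟪y, T x⟫_ℂ - ⟪(x : H), T ⟨y, hy⟩⟫_ℂ) / 2 * Complex.I_sq

namespace PVM

/-- Formal linear combinations of Borel sets. They index the step functions, because these have no
canonical expression as linear combinations of indicator functions. -/
abbrev SetComb : Type := {B : Set ℝ // MeasurableSet B} →₀ ℂ

/-- The step function of a formal linear combination of sets. -/
def stepFn : SetComb →ₗ[ℂ] (ℝ → ℂ) :=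
  Finsupp.linearCombination ℂ fun B => B.1.indicator 1

theorem stepFn_single (B : {B : Set ℝ // MeasurableSet B}) (c : ℂ) :
    stepFn (Finsupp.single B c) = c • B.1.indicator 1 := by
  simp [stepFn]

theorem measurable_stepFn (a : SetComb) : Measurable (stepFn a) := by
  induction a using Finsupp.induction_linear with
  | zero => rw [map_zero]; exact measurable_zero
  | add a b ha hb => rw [map_add]; exact ha.add hb
  | single B c =>
    rw [stepFn_single]
    exact (measurable_one.indicator B.2).const_smul c

theorem bounded_stepFn (a : SetComb) : ∃ C : ℝ, ∀ s, ‖stepFn a s‖ ≤ C := by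
  induction a using Finsupp.induction_linear with
  | zero => exact ⟨0, by simp⟩
  | add a b ha hb =>
    obtain ⟨C, hC⟩ := ha
    obtain ⟨C', hC'⟩ := hb
    refine ⟨C + C', fun s => ?_⟩
    rw [map_add]
    exact (norm_add_le _ _).trans (add_le_add (hC s) (hC' s))
  | single B c =>
    refine ⟨‖c‖, fun s => ?_⟩
    rw [stepFn_single]
    by_cases hs : s ∈ B.1 <;> simp [hs]

theorem exists_stepFn_eq (f : SimpleFunc ℝ ℂ) : ∃ a, stepFn a = f := by
  induction f using SimpleFunc.induction with
  | @const c B hB =>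
    refine ⟨Finsupp.single ⟨B, hB⟩ c, ?_⟩
    rw [stepFn_single]
    ext s
    by_cases h : s ∈ B <;> simp [h]
  | add _ hf hg =>
    obtain ⟨a, ha⟩ := hf
    obtain ⟨b, hb⟩ := hg
    exact ⟨a + b, by rw [map_add, ha, hb, SimpleFunc.coe_add]⟩

theorem integrable_conj_stepFn_mul (a b : SetComb) (ν : Measure ℝ) [IsFiniteMeasure ν] :
    Integrable (fun s => (starRingEnd ℂ) (stepFn a s) * stepFn b s) ν := by
  obtain ⟨C, hC⟩ := bounded_stepFn a
  obtain ⟨C', hC'⟩ := bounded_stepFn b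
  refine Integrable.of_bound (C := C * C') ?_ (.of_forall fun s => ?_)
  · exact ((continuous_star.measurable.comp (measurable_stepFn a)).mul
      (measurable_stepFn b)).aestronglyMeasurable
  · rw [norm_mul, RCLike.norm_conj]
    exact mul_le_mul (hC s) (hC' s) (norm_nonneg _) ((norm_nonneg _).trans (hC s))

variable [CompleteSpace H] (E : PVM H)

/-- The integral of the step function of a formal linear combination of sets. -/
def stepOp : SetComb →ₗ[ℂ] (H →L[ℂ] H) :=
  Finsupp.linearCombination ℂ fun B => E.proj B.1

theorem stepOp_single (B : {B : Set ℝ // MeasurableSet B}) (c : ℂ) :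
    E.stepOp (Finsupp.single B c) = c • E.proj B.1 := by
  simp [stepOp]

theorem exists_stepFn_mul (a b : SetComb) :
    ∃ c, stepFn c = stepFn a * stepFn b ∧ E.stepOp c = E.stepOp a * E.stepOp b := by
  induction a using Finsupp.induction_linear with
  | zero => exact ⟨0, by simp⟩
  | add a a' ha ha' =>
    obtain ⟨c, hc, hc'⟩ := ha
    obtain ⟨d, hd, hd'⟩ := ha'
    exact ⟨c + d, by simp only [map_add, hc, hd, add_mul],
      by simp only [map_add, hc', hd', add_mul]⟩
  | single A c =>
    induction b using Finsupp.induction_linear with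
    | zero => exact ⟨0, by simp⟩
    | add b b' hb hb' =>
      obtain ⟨c, hc, hc'⟩ := hb
      obtain ⟨d, hd, hd'⟩ := hb'
      exact ⟨c + d, by simp only [map_add, hc, hd, mul_add],
        by simp only [map_add, hc', hd', mul_add]⟩
    | single B c' =>
      refine ⟨Finsupp.single ⟨A.1 ∩ B.1, A.2.inter B.2⟩ (c * c'), ?_, ?_⟩
      · simp only [stepFn_single, Set.inter_indicator_one, smul_mul_smul_comm]
      · simp only [stepOp_single, E.proj_inter A B A.2 B.2, smul_mul_smul_comm]

theorem scalar_apply (x : H) {B : Set ℝ} (hB : MeasurableSet B) :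
    E.scalar x B = ENNReal.ofReal (‖E.proj B x‖ ^ 2) :=
  Measure.ofMeasurable_apply B hB

instance (x : H) : IsFiniteMeasure (E.scalar x) :=
  ⟨by rw [E.scalar_apply x .univ]; exact ENNReal.ofReal_lt_top⟩

theorem inner_proj_proj (x : H) {A B : Set ℝ} (hA : MeasurableSet A) (hB : MeasurableSet B) :
    ⟪E.proj A x, E.proj B x⟫_ℂ = ((E.scalar x).real (A ∩ B) : ℂ) := by
  have hsymm : ∀ C, MeasurableSet C → ∀ y z : H, ⟪E.proj C y, z⟫_ℂ = ⟪y, E.proj C z⟫_ℂ :=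
    fun C hC => (E.isStarProjection C hC).isSelfAdjoint.isSymmetric
  have hmul : ∀ C D, MeasurableSet C → MeasurableSet D →
      ∀ y, E.proj C (E.proj D y) = E.proj (C ∩ D) y := fun C D hC hD y => by
    rw [E.proj_inter C D hC hD, mul_apply_eq_comp]
  have hself : ⟪E.proj A x, E.proj B x⟫_ℂ = ⟪E.proj (A ∩ B) x, E.proj (A ∩ B) x⟫_ℂ := by
    rw [hsymm A hA, hmul A B hA hB, hsymm _ (hA.inter hB), hmul _ _ (hA.inter hB) (hA.inter hB),
      Set.inter_self]
  rw [hself, measureReal_def, E.scalar_apply x (hA.inter hB), ENNReal.toReal_ofReal (by positivity),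
    inner_self_eq_norm_sq_to_K, Complex.ofReal_pow]
  rfl

theorem inner_stepOp_single (A B : {B : Set ℝ // MeasurableSet B}) (c c' : ℂ) (x : H) :
    ⟪E.stepOp (Finsupp.single A c) x, E.stepOp (Finsupp.single B c') x⟫_ℂ =
      ∫ s, (starRingEnd ℂ) (stepFn (Finsupp.single A c) s) *
        stepFn (Finsupp.single B c') s ∂(E.scalar x) := by
  have hprod : ∀ s, (starRingEnd ℂ) (stepFn (Finsupp.single A c) s) *
      stepFn (Finsupp.single B c') s =
        (A.1 ∩ B.1).indicator (fun _ => (starRingEnd ℂ) c * c') s := by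
    intro s
    rw [stepFn_single, stepFn_single]
    by_cases hA : s ∈ A.1 <;> by_cases hB : s ∈ B.1 <;> simp [hA, hB]
  simp only [hprod]
  rw [integral_indicator_const _ (A.2.inter B.2), stepOp_single, stepOp_single, smul_apply,
    smul_apply, inner_smul_left, inner_smul_right, E.inner_proj_proj x A.2 B.2, Complex.real_smul]
  ring

theorem inner_stepOp (a b : SetComb) (x : H) :
    ⟪E.stepOp a x, E.stepOp b x⟫_ℂ =
      ∫ s, (starRingEnd ℂ) (stepFn a s) * stepFn b s ∂(E.scalar x) := by
  induction a using Finsupp.induction_linear with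
  | zero => simp
  | add a a' ha ha' =>
    rw [map_add, add_apply, inner_add_left, ha, ha',
      ← integral_add (integrable_conj_stepFn_mul _ _ _) (integrable_conj_stepFn_mul _ _ _)]
    simp only [map_add, Pi.add_apply, add_mul]
  | single A c =>
    induction b using Finsupp.induction_linear with
    | zero => simp
    | add b b' hb hb' =>
      rw [map_add, add_apply, inner_add_right, hb, hb',
        ← integral_add (integrable_conj_stepFn_mul _ _ _) (integrable_conj_stepFn_mul _ _ _)]
      simp only [map_add, Pi.add_apply, mul_add]
    | single B c' => exact E.inner_stepOp_single A B c c' x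

theorem norm_stepOp_sq (a : SetComb) (x : H) :
    ‖E.stepOp a x‖ ^ 2 = ∫ s, ‖stepFn a s‖ ^ 2 ∂(E.scalar x) := by
  have h := E.inner_stepOp a a x
  simp only [inner_self_eq_norm_sq_to_K, RCLike.conj_mul] at h
  exact_mod_cast h

/-- The representation of the step functions defined by a projection-valued measure. -/
def rep : SpectralRep SetComb ℝ H where
  ev := stepFn
  op := E.stepOp
  meas := E.scalar
  finite_meas := inferInstance
  measurable_ev := measurable_stepFn
  bounded_ev := bounded_stepFn
  norm_op_sq := E.norm_stepOp_sq
  exists_mul := E.exists_stepFn_mul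
  exists_one := ⟨Finsupp.single ⟨Set.univ, .univ⟩ 1, by simp [stepFn_single],
    by simp [stepOp_single, E.proj_univ]⟩
  exists_approx ν _ g hg ε hε := by
    obtain ⟨f, hf, -⟩ := hg.exists_simpleFunc_eLpNorm_sub_lt (by simp) hε
    obtain ⟨a, ha⟩ := exists_stepFn_eq f
    exact ⟨a, ha ▸ hf.le⟩

theorem inner_rep_vec (x : H) {g : ℝ → ℝ} (hg : MemLp (fun s => (g s : ℂ)) 2 (E.rep.meas x)) :
    ⟪x, E.rep.vec x fun s => (g s : ℂ)⟫_ℂ = ((∫ s, g s ∂(E.scalar x) : ℝ) : ℂ) :=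
  (SpectralRep.inner_self_vec hg).trans integral_complex_ofReal

theorem integral_apply {g : ℝ → ℝ} (hg : Measurable g) {C : ℝ} (hC : ∀ s, |g s| ≤ C) (x : H) :
    E.integral g x = E.rep.vec x fun s => (g s : ℂ) := by
  have hgm : Measurable fun s => (g s : ℂ) := Complex.measurable_ofReal.comp hg
  have hgb : ∀ s, ‖(g s : ℂ)‖ ≤ C := fun s => by simpa using hC s
  let T := E.rep.fn (fun s => (g s : ℂ)) hgm ⟨C, hgb⟩
  have hT : ∀ x, ⟪x, T x⟫_ℂ = ((∫ s, g s ∂(E.scalar x) : ℝ) : ℂ) := fun x =>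
    E.inner_rep_vec x (.of_bound hgm.aestronglyMeasurable C (.of_forall hgb))
  have hex : ∃ T : H →L[ℂ] H, ∀ x, ⟪x, T x⟫_ℂ = ((∫ s, g s ∂(E.scalar x) : ℝ) : ℂ) := ⟨T, hT⟩
  have hunique : hex.choose.toLinearMap = T.toLinearMap :=
    (ext_inner_map _ _).1 fun y => by
      rw [← inner_conj_symm, ← inner_conj_symm (T.toLinearMap y)]
      exact congrArg _ ((hex.choose_spec y).trans (hT y).symm)
  rw [integral, dif_pos hex]
  exact LinearMap.congr_fun hunique x

variable {E}

namespace IsResolutionOf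

variable {A : H →ₗ.[ℂ] H}

theorem mem_domain_iff (hE : E.IsResolutionOf A) {x : H} :
    x ∈ A.domain ↔ MemLp (fun s : ℝ => (s : ℂ)) 2 (E.rep.meas x) := by
  rw [hE.1 x]
  exact (memLp_two_ofReal_iff measurable_id).symm

theorem apply_eq (hE : E.IsResolutionOf A) (hA : Dense (A.domain : Set H)) (x : A.domain) :
    A x = E.rep.vec x fun s => (s : ℂ) := by
  let V : A.domain →ₗ[ℂ] H :=
    { toFun := fun x => E.rep.vec x fun s => (s : ℂ)
      map_add' := fun x y => SpectralRep.vec_add_left (hE.mem_domain_iff.1 x.2)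
        (hE.mem_domain_iff.1 y.2) (hE.mem_domain_iff.1 (x + y).2)
      map_smul' := fun c x => SpectralRep.vec_smul_left c Complex.measurable_ofReal
        (hE.mem_domain_iff.1 x.2) }
  have hAV : A.toFun - V = 0 := eq_zero_of_inner_self_eq_zero hA fun z => by
    rw [LinearMap.sub_apply, inner_sub_right, sub_eq_zero]
    exact (hE.2 z).trans (E.inner_rep_vec z (hE.mem_domain_iff.1 z.2)).symm
  exact LinearMap.congr_fun (sub_eq_zero.1 hAV) x

theorem mem_graph_iff (hE : E.IsResolutionOf A) (hA : Dense (A.domain : Set H)) {x y : H} :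
    (x, y) ∈ A.graph ↔
      MemLp (fun s : ℝ => (s : ℂ)) 2 (E.rep.meas x) ∧ E.rep.vec x (fun s => (s : ℂ)) = y := by
  simp only [LinearPMap.mem_graph_iff, ← hE.mem_domain_iff]
  constructor
  · rintro ⟨z, rfl, rfl⟩
    exact ⟨z.2, (hE.apply_eq hA z).symm⟩
  · rintro ⟨hx, rfl⟩
    exact ⟨⟨x, hx⟩, rfl, hE.apply_eq hA _⟩

theorem vec_mem_graph (hE : E.IsResolutionOf A) (hA : Dense (A.domain : Set H)) {x : H}
    {g : ℝ → ℂ} (hm : Measurable g) (hg : MemLp g 2 (E.rep.meas x))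
    (hsg : MemLp (fun s : ℝ => (s : ℂ) * g s) 2 (E.rep.meas x)) :
    (E.rep.vec x g, E.rep.vec x fun s : ℝ => (s : ℂ) * g s) ∈ A.graph :=
  (hE.mem_graph_iff hA).2 ⟨(SpectralRep.memLp_vec_iff Complex.measurable_ofReal hm hg).2 hsg,
    SpectralRep.vec_vec Complex.measurable_ofReal hm hg hsg⟩

end IsResolutionOf

end PVM

theorem funCalc_eq [CompleteSpace H] {A : H →ₗ.[ℂ] H} (h : ∃ E : PVM H, E.IsResolutionOf A) :
    ∃ E : PVM H, E.IsResolutionOf A ∧ ∀ g, funCalc A g = E.integral g :=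
  ⟨h.choose, h.choose_spec, fun _ => dif_pos h⟩

end PVMIntegration

/-! ### The spectral theorem -/

section Resolvent

variable {H : Type*} [NormedAddCommGroup H] [InnerProductSpace ℂ H]

theorem inner_eq_of_mem_graph {S T : H →ₗ.[ℂ] H} (h : T.IsFormalAdjoint S) {x u y v : H}
    (hxu : (x, u) ∈ T.graph) (hyv : (y, v) ∈ S.graph) : ⟪u, y⟫_ℂ = ⟪x, v⟫_ℂ := by
  obtain ⟨x, rfl, rfl⟩ := (LinearPMap.mem_graph_iff _).1 hxu
  obtain ⟨y, rfl, rfl⟩ := (LinearPMap.mem_graph_iff _).1 hyv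
  exact h x y

theorem norm_le_norm_add_smul {A : H →ₗ.[ℂ] H} (hA : A.IsFormalAdjoint A) {c : ℂ}
    (hc : (starRingEnd ℂ) c = -c) (hc₁ : ‖c‖ = 1) (x : A.domain) :
    ‖(x : H)‖ ≤ ‖A x + c • (x : H)‖ := by
  have horth : RCLike.re ⟪A x, c • (x : H)⟫_ℂ = 0 := by
    have hreal : (starRingEnd ℂ) ⟪A x, (x : H)⟫_ℂ = ⟪A x, (x : H)⟫_ℂ := by
      rw [inner_conj_symm, hA x x]
    have hanti : (starRingEnd ℂ) ⟪A x, c • (x : H)⟫_ℂ = -⟪A x, c • (x : H)⟫_ℂ := by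
      rw [inner_smul_right, map_mul, hreal, hc, neg_mul]
    have hre := congrArg Complex.re hanti
    rw [Complex.conj_re, Complex.neg_re] at hre
    exact self_eq_neg.1 hre
  have hsq := norm_add_sq (𝕜 := ℂ) (A x) (c • (x : H))
  rw [horth, norm_smul, hc₁, one_mul] at hsq
  refine le_of_sq_le_sq ?_ (norm_nonneg _)
  rw [hsq]
  linarith [sq_nonneg ‖A x‖]

/-- `R` is the bounded inverse `(A + c)⁻¹`, expressed through the graph of `A`. -/
def IsResolvent (A : H →ₗ.[ℂ] H) (c : ℂ) (R : H →L[ℂ] H) : Prop :=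
  ∀ x z, (x, z) ∈ A.graph ↔ R (z + c • x) = x

theorem exists_isResolvent {A : H →ₗ.[ℂ] H} (hA : A.IsFormalAdjoint A) {c : ℂ}
    (hc : (starRingEnd ℂ) c = -c) (hc₁ : ‖c‖ = 1) (hs : ∀ y, ∃ x, (x, y - c • x) ∈ A.graph) :
    ∃ R : H →L[ℂ] H, IsResolvent A c R := by
  let T : A.domain →ₗ[ℂ] H := A.toFun + c • A.domain.subtype
  have hT : ∀ x : A.domain, ‖(x : H)‖ ≤ ‖T x‖ := norm_le_norm_add_smul hA hc hc₁
  have hinj : Function.Injective T := (injective_iff_map_eq_zero T).2 fun x hx => by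
    have hx₀ := hT x
    rw [hx, norm_zero] at hx₀
    exact Subtype.ext (norm_le_zero_iff.1 hx₀)
  have hsurj : Function.Surjective T := fun y => by
    obtain ⟨x, hx⟩ := hs y
    obtain ⟨x, rfl, hAx⟩ := (LinearPMap.mem_graph_iff _).1 hx
    exact ⟨x, eq_sub_iff_add_eq.1 hAx⟩
  let e := LinearEquiv.ofBijective T ⟨hinj, hsurj⟩
  refine ⟨(A.domain.subtype ∘ₗ e.symm.toLinearMap).mkContinuous 1 fun y => ?_, fun x z => ?_⟩
  · rw [one_mul]
    exact (hT (e.symm y)).trans_eq (congrArg norm (e.apply_symm_apply y))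
  · change _ ↔ (e.symm (z + c • x) : H) = x
    rw [LinearPMap.mem_graph_iff]
    constructor
    · rintro ⟨x, rfl, rfl⟩
      exact congrArg Subtype.val (e.symm_apply_apply x)
    · intro hx
      have hex : T (e.symm (z + c • x)) = z + c • x := e.apply_symm_apply _
      refine ⟨e.symm (z + c • x), hx, ?_⟩
      have hAx : A (e.symm (z + c • x)) + c • (e.symm (z + c • x) : H) = z + c • x := hex
      rw [hx] at hAx
      exact add_right_cancel hAx

namespace IsResolvent

variable {A : H →ₗ.[ℂ] H} {c c' : ℂ} {R R' : H →L[ℂ] H}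

theorem mem_graph (hR : IsResolvent A c R) (y : H) : (R y, y - c • R y) ∈ A.graph := by
  rw [hR, sub_add_cancel]

theorem injective (hR : IsResolvent A c R) : Function.Injective R := by
  refine (injective_iff_map_eq_zero R).2 fun y hy => ?_
  have hmem := hR.mem_graph y
  rw [hy, smul_zero, sub_zero] at hmem
  exact A.graph_fst_eq_zero_snd hmem rfl

theorem sub_eq (hR : IsResolvent A c R) (hR' : IsResolvent A c' R') :
    R - R' = (c' - c) • (R' * R) := by
  ext y
  have hmem := (hR' _ _).1 (hR.mem_graph y)
  rw [sub_add_eq_add_sub, add_sub_assoc, ← sub_smul, map_add, map_smul] at hmem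
  exact sub_eq_of_eq_add' hmem.symm

theorem commute (hR : IsResolvent A c R) (hR' : IsResolvent A c' R') (hc : c ≠ c') :
    Commute R' R := by
  have hsub : (c' - c) • (R' * R) = (c' - c) • (R * R') := by
    rw [← hR.sub_eq hR', ← neg_sub c, neg_smul, ← hR'.sub_eq hR, neg_sub]
  exact smul_right_injective _ (sub_ne_zero.2 hc.symm) hsub

theorem star_eq [CompleteSpace H] (hA : A.IsFormalAdjoint A) (hR : IsResolvent A c R)
    (hR' : IsResolvent A ((starRingEnd ℂ) c) R') : star R = R' := by
  rw [ContinuousLinearMap.star_eq_adjoint, eq_comm, ContinuousLinearMap.eq_adjoint_iff]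
  intro x y
  have h := inner_eq_of_mem_graph hA (hR'.mem_graph x) (hR.mem_graph y)
  rw [inner_sub_left, inner_sub_right, inner_smul_left, inner_smul_right, Complex.conj_conj] at h
  exact (sub_left_inj.1 h).symm

end IsResolvent

end Resolvent

section ContinuousRep

variable {H : Type*} [NormedAddCommGroup H] [InnerProductSpace ℂ H] [CompleteSpace H]
  {X : Type*} [MetricSpace X]

theorem inner_starHom_mul (Φ : C(X, ℂ) →⋆ₐ[ℂ] (H →L[ℂ] H)) (f : C(X, ℂ)) (x : H) :
    ⟪x, Φ (star f * f) x⟫_ℂ = ((‖Φ f x‖ ^ 2 : ℝ) : ℂ) := by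
  rw [map_mul, map_star, ContinuousLinearMap.star_eq_adjoint, mul_apply_eq_comp,
    ContinuousLinearMap.adjoint_inner_right, inner_self_eq_norm_sq_to_K]
  norm_cast

/-- The real-linear functional `f ↦ re ⟪x, Φ f x⟫` on the real continuous functions. -/
def reInnerFunctional (Φ : C(X, ℂ) →⋆ₐ[ℂ] (H →L[ℂ] H)) (x : H) : C(X, ℝ) →ₗ[ℝ] ℝ :=
  Complex.reLm ∘ₗ ((innerₛₗ ℂ x).restrictScalars ℝ) ∘ₗ
    ((LinearMap.applyₗ x ∘ₗ ContinuousLinearMap.coeLM ℂ ∘ₗ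
      Φ.toAlgHom.toLinearMap).restrictScalars ℝ) ∘ₗ
    (Complex.ofRealCLM.compLeftContinuous ℝ X).toLinearMap

theorem reInnerFunctional_apply_of_eq_star_mul (Φ : C(X, ℂ) →⋆ₐ[ℂ] (H →L[ℂ] H)) (x : H)
    {f : C(X, ℝ)} {g : C(X, ℂ)} (hfg : ∀ s, (f s : ℂ) = star (g s) * g s) :
    reInnerFunctional Φ x f = ‖Φ g x‖ ^ 2 := by
  have hf : Complex.ofRealCLM.compLeftContinuous ℝ X f = star g * g := ContinuousMap.ext hfg
  change (⟪x, Φ (Complex.ofRealCLM.compLeftContinuous ℝ X f) x⟫_ℂ).re = _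
  rw [hf, inner_starHom_mul, Complex.ofReal_re]

variable [CompactSpace X] [MeasurableSpace X] [BorelSpace X]

/-- The positive functional `f ↦ ⟪x, Φ f x⟫` whose Riesz measure is the spectral measure of `x`. -/
def vectorFunctional (Φ : C(X, ℂ) →⋆ₐ[ℂ] (H →L[ℂ] H)) (x : H) :
    CompactlySupportedContinuousMap X ℝ →ₚ[ℝ] ℝ :=
  PositiveLinearMap.mk₀
    { toFun := fun f => reInnerFunctional Φ x f.toContinuousMap
      map_add' := fun f g => map_add (reInnerFunctional Φ x) f.toContinuousMap g.toContinuousMap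
      map_smul' := fun c f => map_smul (reInnerFunctional Φ x) c f.toContinuousMap }
    fun f hf => by
      let g : C(X, ℂ) := ⟨fun s => (√(f s) : ℂ), by fun_prop⟩
      refine (sq_nonneg _).trans_eq
        (reInnerFunctional_apply_of_eq_star_mul Φ x (g := g) fun s => ?_).symm
      change ((f s : ℝ) : ℂ) = (starRingEnd ℂ) (√(f s) : ℂ) * (√(f s) : ℂ)
      rw [Complex.conj_ofReal, ← Complex.ofReal_mul, Real.mul_self_sqrt (hf s)]

/-- The continuous functional calculus extended to square integrable functions: the algebra is
`C(X, ℂ)`, represented by `Φ`. -/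
def continuousRep (Φ : C(X, ℂ) →⋆ₐ[ℂ] (H →L[ℂ] H)) : SpectralRep C(X, ℂ) X H where
  ev := ContinuousMap.coeFnLinearMap ℂ
  op := Φ.toAlgHom.toLinearMap
  meas x := RealRMK.rieszMeasure (vectorFunctional Φ x)
  finite_meas x := by
    have := RealRMK.regular_rieszMeasure (vectorFunctional Φ x)
    infer_instance
  measurable_ev f := f.continuous.measurable
  bounded_ev f := ⟨‖f‖, f.norm_coe_le_norm⟩
  norm_op_sq f x := by
    let g : CompactlySupportedContinuousMap X ℝ :=
      { toFun := fun s => ‖f s‖ ^ 2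
        continuous_toFun := by fun_prop
        hasCompactSupport' := HasCompactSupport.of_compactSpace _ }
    have hg : vectorFunctional Φ x g = ‖Φ f x‖ ^ 2 :=
      reInnerFunctional_apply_of_eq_star_mul Φ x fun s => by
        change ((‖f s‖ ^ 2 : ℝ) : ℂ) = (starRingEnd ℂ) (f s) * f s
        rw [RCLike.conj_mul]
        norm_cast
    exact hg.symm.trans (RealRMK.integral_rieszMeasure (vectorFunctional Φ x) g).symm
  exists_mul f g := ⟨f * g, rfl, map_mul Φ f g⟩
  exists_one := ⟨1, rfl, map_one Φ⟩
  exists_approx ν _ g hg ε hε := by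
    obtain ⟨f, hf, -⟩ := hg.exists_boundedContinuous_eLpNorm_sub_le (by simp) hε
    exact ⟨f.toContinuousMap, hf⟩

end ContinuousRep

namespace SpectralRep

variable {𝒜 X H : Type*} [AddCommGroup 𝒜] [Module ℂ 𝒜] [MeasurableSpace X]
  [NormedAddCommGroup H] [InnerProductSpace ℂ H] [CompleteSpace H] (S : SpectralRep 𝒜 X H)

theorem memLp_indicator_one {B : Set X} (hB : MeasurableSet B) (ν : Measure X)
    [IsFiniteMeasure ν] : MemLp (B.indicator (1 : X → ℂ)) 2 ν :=
  (memLp_const (1 : ℂ)).indicator hB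

open Classical in
/-- The spectral projection of a measurable subset of `X` (and `0` for nonmeasurable sets). -/
def proj (B : Set X) : H →L[ℂ] H :=
  if hB : MeasurableSet B then S.fn (B.indicator 1) (measurable_one.indicator hB)
    ⟨1, fun s => (norm_indicator_le_norm_self _ s).trans_eq norm_one⟩ else 0

theorem proj_apply {B : Set X} (hB : MeasurableSet B) (x : H) :
    S.proj B x = S.vec x (B.indicator 1) := by
  rw [proj, dif_pos hB, fn_apply]

theorem enorm_proj_sq {B : Set X} (hB : MeasurableSet B) (x : H) :
    ‖S.proj B x‖ₑ ^ 2 = S.meas x B := by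
  have hsq : ∀ s, ‖B.indicator (1 : X → ℂ) s‖ₑ ^ 2 = B.indicator 1 s := fun s => by
    by_cases hs : s ∈ B <;> simp [hs]
  simp only [S.proj_apply hB, enorm_vec (memLp_indicator_one hB _), eLpNorm_two_sq, hsq,
    lintegral_indicator_one hB]

theorem proj_inter {A B : Set X} (hA : MeasurableSet A) (hB : MeasurableSet B) :
    S.proj (A ∩ B) = S.proj A * S.proj B := by
  ext x
  have hind : A.indicator (1 : X → ℂ) * B.indicator 1 = (A ∩ B).indicator 1 :=
    Set.inter_indicator_one.symm
  rw [mul_apply_eq_comp, S.proj_apply hA, S.proj_apply hB, S.proj_apply (hA.inter hB), ← hind]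
  refine (vec_vec (measurable_one.indicator hA) (measurable_one.indicator hB)
    (memLp_indicator_one hB _) ?_).symm
  rw [hind]
  exact memLp_indicator_one (hA.inter hB) _

theorem inner_proj (x : H) {B : Set X} (hB : MeasurableSet B) :
    ⟪x, S.proj B x⟫_ℂ = ((S.meas x).real B : ℂ) := by
  rw [S.proj_apply hB, inner_self_vec (memLp_indicator_one hB _)]
  refine (integral_indicator_const (1 : ℂ) hB).trans ?_
  rw [Complex.real_smul, mul_one]

theorem isStarProjection_proj {B : Set X} (hB : MeasurableSet B) :
    IsStarProjection (S.proj B) := by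
  refine ⟨?_, ?_⟩
  · rw [IsIdempotentElem, ← S.proj_inter hB hB, Set.inter_self]
  · rw [ContinuousLinearMap.isSelfAdjoint_iff_isSymmetric,
      LinearMap.isSymmetric_iff_inner_map_self_real]
    intro x
    change (starRingEnd ℂ) ⟪S.proj B x, x⟫_ℂ = ⟪S.proj B x, x⟫_ℂ
    rw [inner_conj_symm, ← inner_conj_symm (S.proj B x), S.inner_proj x hB, Complex.conj_ofReal]

theorem sum_proj {A : ℕ → Set X} (hA : ∀ n, MeasurableSet (A n))
    (hd : Pairwise (Function.onFun Disjoint A)) (F : Finset ℕ) (x : H) :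
    ∑ n ∈ F, S.proj (A n) x = S.vec x ((⋃ n ∈ F, A n).indicator 1) := by
  rw [Finset.indicator_biUnion F A fun m _ n _ hmn => hd hmn]
  induction F using Finset.cons_induction with
  | empty =>
    simp only [Finset.sum_empty]
    exact (vec_zero x).symm
  | cons n F hn ih =>
    have hF : MemLp (fun s => ∑ n ∈ F, (A n).indicator (1 : X → ℂ) s) 2 (S.meas x) :=
      memLp_finsetSum F fun n _ => memLp_indicator_one (hA n) _
    simp only [Finset.sum_cons]
    rw [ih, S.proj_apply (hA n)]
    exact (vec_add (memLp_indicator_one (hA n) _) hF).symm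

theorem hasSum_proj {A : ℕ → Set X} (hA : ∀ n, MeasurableSet (A n))
    (hd : Pairwise (Function.onFun Disjoint A)) (x : H) :
    HasSum (fun n => S.proj (A n) x) (S.proj (⋃ n, A n) x) := by
  rw [HasSum, S.proj_apply (MeasurableSet.iUnion hA)]
  simp only [S.sum_proj hA hd]
  refine tendsto_vec_of_dominated (b := 1) (memLp_const 1)
    (fun F => measurable_one.indicator (F.measurableSet_biUnion fun n _ => hA n))
    (measurable_one.indicator (MeasurableSet.iUnion hA))
    (fun F s => norm_indicator_le_norm_self _ s)
    fun s => (tendsto_indicator_biUnion_finset A 1 s).mono_right (pure_le_nhds _)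

/-- The projection-valued measure on `ℝ` obtained by transport along a measurable function. -/
def pvm (κ : X → ℝ) (hκ : Measurable κ) : PVM H where
  proj B := S.proj (κ ⁻¹' B)
  isStarProjection B hB := S.isStarProjection_proj (hκ hB)
  proj_univ := by
    ext x
    rw [S.proj_apply (hκ .univ), Set.preimage_univ, Set.indicator_univ, vec_one, one_apply_eq_self]
  proj_empty := by
    ext x
    rw [S.proj_apply (hκ .empty), Set.preimage_empty, Set.indicator_empty]
    exact vec_zero x
  proj_inter A B hA hB := S.proj_inter (hκ hA) (hκ hB)
  hasSum_proj A hA hd x := by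
    rw [Set.preimage_iUnion]
    exact S.hasSum_proj (fun n => hκ (hA n)) (fun m n h => (hd h).preimage κ) x

theorem scalar_pvm (κ : X → ℝ) (hκ : Measurable κ) (x : H) :
    (S.pvm κ hκ).scalar x = (S.meas x).map κ := by
  ext B hB
  rw [PVM.scalar_apply _ _ hB, Measure.map_apply hκ hB, ENNReal.ofReal_pow (norm_nonneg _),
    ofReal_norm]
  exact S.enorm_proj_sq (hκ hB) x

variable {S}

theorem isResolutionOf_pvm {κ : X → ℝ} (hκ : Measurable κ) {A : H →ₗ.[ℂ] H}
    (hA : ∀ {x z}, (x, z) ∈ A.graph ↔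
      MemLp (fun s => (κ s : ℂ)) 2 (S.meas x) ∧ S.vec x (fun s => (κ s : ℂ)) = z) :
    (S.pvm κ hκ).IsResolutionOf A := by
  refine ⟨fun x => ?_, fun x => ?_⟩
  · rw [LinearPMap.mem_domain_iff, S.scalar_pvm,
      integrable_map_measure (by fun_prop) hκ.aemeasurable]
    simp only [hA, exists_and_left, exists_eq', and_true]
    exact memLp_two_ofReal_iff hκ
  · obtain ⟨hx, hAx⟩ := hA.1 (A.mem_graph x)
    rw [← hAx, inner_self_vec hx, S.scalar_pvm, integral_map hκ.aemeasurable (by fun_prop),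
      integral_complex_ofReal]

theorem ae_ev_ne_zero {a : 𝒜} (ha : Function.Injective (S.op a)) (x : H) :
    ∀ᵐ s ∂(S.meas x), S.ev a s ≠ 0 := by
  have hB : MeasurableSet {s | S.ev a s = 0} := S.measurable_ev a (measurableSet_singleton 0)
  have hker : S.ev a * {s | S.ev a s = 0}.indicator 1 = 0 := by
    ext s
    by_cases hs : S.ev a s = 0 <;> simp [hs]
  have hproj : S.proj {s | S.ev a s = 0} x = 0 := ha <| by
    rw [map_zero, S.proj_apply hB, op_vec _ (memLp_indicator_one hB _), hker, vec_zero]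
  have hmeas := S.enorm_proj_sq hB x
  rw [hproj, enorm_zero, zero_pow two_ne_zero] at hmeas
  simpa only [ae_iff, not_not] using hmeas.symm

theorem mem_graph_iff_of_isResolvent {A : H →ₗ.[ℂ] H} {c : ℂ} {a : 𝒜}
    (hR : IsResolvent A c (S.op a)) {κ : X → ℂ} (hκ : Measurable κ)
    (hinv : ∀ s, S.ev a s ≠ 0 → S.ev a s * (κ s + c) = 1) {x z : H} :
    (x, z) ∈ A.graph ↔ MemLp κ 2 (S.meas x) ∧ S.vec x κ = z := by
  have hvec : ∀ {x}, MemLp κ 2 (S.meas x) → S.op a (S.vec x κ + c • x) = x := fun {x} hx => by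
    have hc : MemLp (c • (1 : X → ℂ)) 2 (S.meas x) := memLp_const (c • (1 : ℂ))
    have hcx : S.vec x (c • (1 : X → ℂ)) = c • x := by
      rw [vec_const_smul (g := 1) c (memLp_const (1 : ℂ)), vec_one]
    rw [← hcx, ← vec_add hx hc, op_vec _ (hx.add hc)]
    conv_rhs => rw [← vec_one (S := S) x]
    refine vec_congr ?_
    filter_upwards [ae_ev_ne_zero hR.injective x] with s hs
    simpa using hinv s hs
  have hbound : ∀ y, MemLp (κ * S.ev a) 2 (S.meas y) := fun y => by
    obtain ⟨C, hC⟩ := S.bounded_ev a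
    refine .of_bound (hκ.mul (S.measurable_ev a)).aestronglyMeasurable (1 + ‖c‖ * C) <| by
      filter_upwards [ae_ev_ne_zero hR.injective y] with s hs
      have hκs : κ s * S.ev a s = 1 - c * S.ev a s := by linear_combination hinv s hs
      calc ‖κ s * S.ev a s‖ ≤ ‖(1 : ℂ)‖ + ‖c * S.ev a s‖ := hκs ▸ norm_sub_le _ _
        _ ≤ 1 + ‖c‖ * C := by
          rw [norm_one, norm_mul]
          gcongr
          exact hC s
  constructor
  · intro h
    have hx : x = S.vec (z + c • x) (S.ev a) := ((vec_ev _ _).trans ((hR x z).1 h)).symm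
    have hmem : MemLp κ 2 (S.meas x) := by
      rw [hx, memLp_vec_iff hκ (S.measurable_ev a) (S.memLp_ev a _)]
      exact hbound _
    exact ⟨hmem, add_right_cancel (hR.injective ((hvec hmem).trans ((hR x z).1 h).symm))⟩
  · rintro ⟨hx, rfl⟩
    exact (hR _ _).2 (hvec hx)

end SpectralRep

section SpectralTheorem

variable {H : Type*} [NormedAddCommGroup H] [InnerProductSpace ℂ H] [CompleteSpace H]

theorem conj_sub_self_of_mem_spectrum {R : H →L[ℂ] H} (hR : IsStarNormal R) {c : ℂ}
    (hc : R - star R = c • (star R * R)) (s : spectrum ℂ R) :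
    (s : ℂ) - (starRingEnd ℂ) s = c * ((starRingEnd ℂ) s * s) := by
  let ι : C(spectrum ℂ R, ℂ) := (ContinuousMap.id ℂ).restrict (spectrum ℂ R)
  have hι : cfcHom hR ι = R := cfcHom_id hR
  have hmap : cfcHom hR (ι - star ι) = cfcHom hR (c • (star ι * ι)) := by
    rw [map_sub, map_smul, map_mul, map_star, hι, hc]
  exact ContinuousMap.congr_fun (cfcHom_injective hR hmap) s

theorem mul_re_inv_add_I {s : ℂ} (hs : s ≠ 0)
    (h : s - (starRingEnd ℂ) s = (-Complex.I - Complex.I) * ((starRingEnd ℂ) s * s)) :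
    s * ((s⁻¹.re : ℂ) + Complex.I) = 1 := by
  have hs' : (starRingEnd ℂ) s ≠ 0 := (map_ne_zero _).2 hs
  have hsub : s⁻¹ - (starRingEnd ℂ) s⁻¹ = 2 * Complex.I := by
    rw [map_inv₀]
    field_simp
    linear_combination -h
  have him : s⁻¹.im = 1 := by
    rw [Complex.sub_conj, mul_left_inj' Complex.I_ne_zero] at hsub
    have : 2 * s⁻¹.im = 2 := mod_cast hsub
    linarith
  have hinv : (s⁻¹.re : ℂ) + Complex.I = s⁻¹ := by
    conv_rhs => rw [← Complex.re_add_im s⁻¹, him, Complex.ofReal_one, one_mul]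
  rw [hinv, mul_inv_cancel₀ hs]

theorem dense_domain_of_isFormalAdjoint_self {A : H →ₗ.[ℂ] H} (hA : A.IsFormalAdjoint A)
    (hadd : ∀ y, ∃ x, (x, y - Complex.I • x) ∈ A.graph)
    (hsub : ∀ y, ∃ x, (x, y - (-Complex.I) • x) ∈ A.graph) : Dense (A.domain : Set H) := by
  rw [Submodule.dense_iff_topologicalClosure_eq_top, Submodule.topologicalClosure_eq_top_iff,
    Submodule.eq_bot_iff]
  intro z hz
  obtain ⟨x, hx⟩ := hadd z
  obtain ⟨y, hy⟩ := hsub x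
  have horth : ⟪z, y⟫_ℂ = 0 :=
    (Submodule.mem_orthogonal' _ _).1 hz y (LinearPMap.mem_domain_of_mem_graph hy)
  have hxx : ⟪x, x⟫_ℂ = 0 := by
    have hsymm := inner_eq_of_mem_graph hA hx hy
    rw [inner_sub_left, inner_sub_right, inner_smul_left, inner_smul_right, Complex.conj_I,
      horth] at hsymm
    linear_combination -hsymm
  rw [inner_self_eq_zero.1 hxx, smul_zero, sub_zero] at hx
  exact A.graph_fst_eq_zero_snd hx rfl

theorem exists_isResolutionOf {A : H →ₗ.[ℂ] H} (hA : A.IsFormalAdjoint A)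
    (hadd : ∀ y, ∃ x, (x, y - Complex.I • x) ∈ A.graph)
    (hsub : ∀ y, ∃ x, (x, y - (-Complex.I) • x) ∈ A.graph) :
    ∃ E : PVM H, E.IsResolutionOf A := by
  obtain ⟨R, hR⟩ := exists_isResolvent hA (by simp) (by simp) hadd
  obtain ⟨R', hR'⟩ := exists_isResolvent hA (by simp) (by simp) hsub
  obtain rfl : star R = R' := hR.star_eq hA (Complex.conj_I ▸ hR')
  have hnormal : IsStarNormal R := ⟨hR.commute hR' (self_ne_neg.2 Complex.I_ne_zero)⟩
  let ι : C(spectrum ℂ R, ℂ) := (ContinuousMap.id ℂ).restrict (spectrum ℂ R)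
  let S := continuousRep (cfcHom hnormal)
  have hι : S.op ι = R := cfcHom_id hnormal
  have hκ : Measurable fun s : spectrum ℂ R => (s : ℂ)⁻¹.re :=
    Complex.measurable_re.comp measurable_subtype_coe.inv
  have hinv : ∀ s : spectrum ℂ R, S.ev ι s ≠ 0 →
      S.ev ι s * (((s : ℂ)⁻¹.re : ℂ) + Complex.I) = 1 := fun s hs =>
    mul_re_inv_add_I hs (conj_sub_self_of_mem_spectrum hnormal (hR.sub_eq hR') s)
  have hRι : IsResolvent A Complex.I (S.op ι) := by rwa [hι]
  exact ⟨S.pvm _ hκ, SpectralRep.isResolutionOf_pvm hκ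
    (SpectralRep.mem_graph_iff_of_isResolvent hRι (Complex.measurable_ofReal.comp hκ) hinv)⟩

end SpectralTheorem

/-! ### Hilbert complexes -/

section Graph

theorem mem_graph_add_iff {R E F : Type*} [Ring R] [AddCommGroup E] [Module R E]
    [AddCommGroup F] [Module R F] {f g : E →ₗ.[R] F} {x : E} {y : F} :
    (x, y) ∈ (f + g).graph ↔ ∃ u v, (x, u) ∈ f.graph ∧ (x, v) ∈ g.graph ∧ u + v = y := by
  simp only [LinearPMap.mem_graph_iff]
  constructor
  · rintro ⟨z, rfl, rfl⟩
    exact ⟨_, _, ⟨⟨z, z.2.1⟩, rfl, rfl⟩, ⟨⟨z, z.2.2⟩, rfl, rfl⟩, rfl⟩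
  · rintro ⟨_, _, ⟨z, rfl, rfl⟩, ⟨⟨_, hz⟩, rfl, rfl⟩, rfl⟩
    exact ⟨⟨z, z.2, hz⟩, rfl, rfl⟩

variable {H : Type*} [NormedAddCommGroup H] [InnerProductSpace ℂ H]

theorem mem_graph_opMul_iff {f g : H →ₗ.[ℂ] H} {x y : H} :
    (x, y) ∈ (opMul g f).graph ↔ ∃ u, (x, u) ∈ f.graph ∧ (u, y) ∈ g.graph := by
  simp only [LinearPMap.mem_graph_iff]
  constructor
  · rintro ⟨⟨_, ⟨w, hw, rfl⟩, hz⟩, rfl, rfl⟩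
    exact ⟨f w, ⟨w, rfl, rfl⟩, ⟨⟨f w, hw⟩, rfl, rfl⟩⟩
  · rintro ⟨_, ⟨z, rfl, rfl⟩, ⟨⟨_, hz⟩, rfl, rfl⟩⟩
    exact ⟨⟨z, ⟨z, hz, rfl⟩, z.2⟩, rfl, rfl⟩

variable [CompleteSpace H] {d : H →ₗ.[ℂ] H}

theorem mem_graph_adjoint_iff (hd : Dense (d.domain : Set H)) {z w : H} :
    (z, w) ∈ d†.graph ↔ ∀ x y, (x, y) ∈ d.graph → ⟪y, z⟫_ℂ = ⟪x, w⟫_ℂ := by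
  simp only [LinearPMap.adjoint_graph_eq_graph_adjoint hd, Submodule.mem_adjoint_iff, sub_eq_zero]

theorem exists_graph_decomposition (hc : d.IsClosed) (hd : Dense (d.domain : Set H)) (a b : H) :
    ∃ x y z w, (x, y) ∈ d.graph ∧ (z, w) ∈ d†.graph ∧ a = x - w ∧ b = y + z := by
  let K : Submodule ℂ (WithLp 2 (H × H)) :=
    d.graph.comap (WithLp.linearEquiv 2 ℂ (H × H)).toLinearMap
  have hK : IsClosed (K : Set (WithLp 2 (H × H))) :=
    IsClosed.preimage (WithLp.prod_continuous_ofLp 2 H H) hc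
  have : CompleteSpace K := hK.completeSpace_coe
  obtain ⟨p, hp, o, ho, hpo⟩ := K.exists_add_mem_mem_orthogonal (WithLp.toLp 2 (a, b))
  refine ⟨p.fst, p.snd, o.snd, -o.fst, hp, ?_, ?_, congrArg WithLp.snd hpo⟩
  · rw [mem_graph_adjoint_iff hd]
    intro x y hxy
    have horth : ⟪x, o.fst⟫_ℂ + ⟪y, o.snd⟫_ℂ = 0 :=
      (Submodule.mem_orthogonal K o).1 ho (WithLp.toLp 2 (x, y)) hxy
    rw [inner_neg_right]
    linear_combination horth
  · rw [sub_neg_eq_add]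
    exact congrArg WithLp.fst hpo

theorem exists_add_eq_of_mem_graph_adjoint_mul (hc : d.IsClosed) (hd : Dense (d.domain : Set H))
    (b : H) : ∃ x y z, (x, y) ∈ d.graph ∧ (y, z) ∈ d†.graph ∧ x + z = b := by
  obtain ⟨x, y, z, w, hxy, hzw, rfl, hyz⟩ := exists_graph_decomposition hc hd b 0
  obtain rfl : z = -y := (neg_eq_of_add_eq_zero_right hyz.symm).symm
  exact ⟨x, y, -w, hxy, by simpa using neg_mem hzw, (sub_eq_add_neg x w).symm⟩

theorem exists_add_eq_of_mem_graph_mul_adjoint (hc : d.IsClosed) (hd : Dense (d.domain : Set H))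
    (b : H) : ∃ x y z, (x, y) ∈ d†.graph ∧ (y, z) ∈ d.graph ∧ x + z = b := by
  obtain ⟨x, y, z, w, hxy, hzw, hxw, rfl⟩ := exists_graph_decomposition hc hd 0 b
  obtain rfl : x = w := sub_eq_zero.1 hxw.symm
  exact ⟨z, x, y, hzw, hxy, add_comm z y⟩

end Graph

/-- An unbounded Hilbert complex, rolled up into a single closed densely defined operator `d` whose
range lies in its kernel. The condition `d ∘ d = 0` is expressed through the graph of `d`. -/
structure IsHilbertComplex {H : Type*} [NormedAddCommGroup H] [InnerProductSpace ℂ H]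
    (d : H →ₗ.[ℂ] H) : Prop where
  isClosed : d.IsClosed
  dense_domain : Dense (d.domain : Set H)
  mem_graph_zero : ∀ {x y}, (x, y) ∈ d.graph → (y, 0) ∈ d.graph

namespace IsHilbertComplex

variable {H : Type*} [NormedAddCommGroup H] [InnerProductSpace ℂ H] [CompleteSpace H]
  {d : H →ₗ.[ℂ] H}

theorem mem_graph_adjoint_zero (hd : IsHilbertComplex d) {z w : H} (h : (z, w) ∈ d†.graph) :
    (w, 0) ∈ d†.graph := by
  rw [mem_graph_adjoint_iff hd.dense_domain] at h ⊢
  intro x y hxy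
  rw [inner_zero_right, ← h y 0 (hd.mem_graph_zero hxy), inner_zero_left]

theorem mem_graph_laplacian_iff (hd : IsHilbertComplex d) {x y : H} :
    (x, y) ∈ (opMul d† d + opMul d d†).graph ↔
      ∃ u, (x, u) ∈ (d + d†).graph ∧ (u, y) ∈ (d + d†).graph := by
  simp only [mem_graph_add_iff, mem_graph_opMul_iff]
  constructor
  · rintro ⟨u, v, ⟨p, hxp, hpu⟩, ⟨r, hxr, hrv⟩, rfl⟩
    refine ⟨p + r, ⟨p, r, hxp, hxr, rfl⟩, ⟨v, u, ?_, ?_, add_comm v u⟩⟩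
    · simpa using add_mem (hd.mem_graph_zero hxp) hrv
    · simpa using add_mem hpu (hd.mem_graph_adjoint_zero hxr)
  · rintro ⟨_, ⟨p, r, hxp, hxr, rfl⟩, ⟨v, u, hv, hu, rfl⟩⟩
    refine ⟨u, v, ⟨p, hxp, ?_⟩, ⟨r, hxr, ?_⟩, add_comm u v⟩
    · simpa using sub_mem hu (hd.mem_graph_adjoint_zero hxr)
    · simpa using sub_mem hv (hd.mem_graph_zero hxp)

theorem laplacian_eq_opMul_dirac (hd : IsHilbertComplex d) :
    opMul d† d + opMul d d† = opMul (d + d†) (d + d†) :=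
  LinearPMap.eq_of_eq_graph <| Submodule.ext fun _ =>
    hd.mem_graph_laplacian_iff.trans mem_graph_opMul_iff.symm

theorem isFormalAdjoint_dirac (hd : IsHilbertComplex d) :
    (d + d†).IsFormalAdjoint (d + d†) := by
  intro x y
  obtain ⟨p, r, hp, hr, hpr⟩ := mem_graph_add_iff.1 (LinearPMap.mem_graph _ x)
  obtain ⟨p', r', hp', hr', hpr'⟩ := mem_graph_add_iff.1 (LinearPMap.mem_graph _ y)
  have hadj := LinearPMap.adjoint_isFormalAdjoint hd.dense_domain
  rw [← hpr, ← hpr', inner_add_left, inner_add_right, inner_eq_of_mem_graph hadj hr hp',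
    inner_eq_of_mem_graph hadj.symm hp hr', add_comm]

theorem exists_laplacian_add_eq (hd : IsHilbertComplex d) (b : H) :
    ∃ x y, (x, y) ∈ (opMul d† d + opMul d d†).graph ∧ x + y = b := by
  obtain ⟨x₀, u, v, hu, hv, rfl⟩ :=
    exists_add_eq_of_mem_graph_adjoint_mul hd.isClosed hd.dense_domain b
  obtain ⟨x, w, z, hw, hz, rfl⟩ :=
    exists_add_eq_of_mem_graph_mul_adjoint hd.isClosed hd.dense_domain x₀
  have hxu : (x, u) ∈ d.graph := by simpa using sub_mem hu (hd.mem_graph_zero hz)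
  refine ⟨x, v + z, mem_graph_add_iff.2 ⟨v, z, ?_, ?_, rfl⟩, by abel⟩
  · exact mem_graph_opMul_iff.2 ⟨u, hxu, hv⟩
  · exact mem_graph_opMul_iff.2 ⟨w, hw, hz⟩

theorem exists_mem_graph_dirac (hd : IsHilbertComplex d) {c : ℂ} (hc : c * c = -1) (b : H) :
    ∃ x, (x, b - c • x) ∈ (d + d†).graph := by
  obtain ⟨x, y, hxy, rfl⟩ := hd.exists_laplacian_add_eq b
  obtain ⟨u, hxu, huy⟩ := hd.mem_graph_laplacian_iff.1 hxy
  have hfactor : x + y - c • (u - c • x) = y - c • u := by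
    rw [smul_sub, smul_smul, hc]
    module
  exact ⟨u - c • x, hfactor ▸ sub_mem huy (Submodule.smul_mem _ c hxu)⟩

theorem dense_domain_dirac (hd : IsHilbertComplex d) : Dense ((d + d†).domain : Set H) :=
  dense_domain_of_isFormalAdjoint_self hd.isFormalAdjoint_dirac
    (hd.exists_mem_graph_dirac (by simp)) (hd.exists_mem_graph_dirac (by simp))

theorem exists_isResolutionOf_dirac (hd : IsHilbertComplex d) :
    ∃ E : PVM H, E.IsResolutionOf (d + d†) :=
  exists_isResolutionOf hd.isFormalAdjoint_dirac
    (hd.exists_mem_graph_dirac (by simp)) (hd.exists_mem_graph_dirac (by simp))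

end IsHilbertComplex

/-! ### Bessel functions -/

section BesselSeries

/-- The coefficients of the power series of `φ_n` in the variable `z = r²`. They are read off from
the equation `4 z g'' + 2 n g' + g = 0` satisfied by `g(r²) = φ_n(r)`. -/
def besselCoeff (n k : ℕ) : ℝ :=
  (-1) ^ k / ∏ j ∈ Finset.range k, ((2 * j + 2 : ℝ) * (2 * j + n))

theorem besselCoeff_zero (n : ℕ) : besselCoeff n 0 = 1 := by
  simp [besselCoeff]

theorem besselCoeff_succ (n k : ℕ) :
    besselCoeff n (k + 1) = -besselCoeff n k / ((2 * k + 2) * (2 * k + n)) := by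
  rw [besselCoeff, besselCoeff, Finset.prod_range_succ, pow_succ, mul_neg_one, neg_div, neg_div,
    div_div]

variable {n : ℕ}

theorem succ_mul_besselCoeff (hn : 1 ≤ n) (k : ℕ) :
    (k + 1) * besselCoeff n (k + 1) = -(1 / (2 * n)) * besselCoeff (n + 2) k := by
  have : (0 : ℝ) < n := by exact_mod_cast hn
  induction k with
  | zero =>
    rw [besselCoeff_succ, besselCoeff_zero, besselCoeff_zero]
    field_simp
    simp
  | succ k ih =>
    have hprev : besselCoeff n (k + 1) = -(1 / (2 * n)) * besselCoeff (n + 2) k / (k + 1) := by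
      rw [← ih]
      field_simp
    rw [besselCoeff_succ n (k + 1), besselCoeff_succ (n + 2) k, hprev]
    push_cast
    have : (2 * k + (n + 2) : ℝ) ≠ 0 := by positivity
    have : (2 * (k + 1) + n : ℝ) ≠ 0 := by positivity
    field_simp
    ring

theorem besselCoeff_three_term (hn : 1 ≤ n) (k : ℕ) :
    besselCoeff n (k + 1) - besselCoeff (n + 2) (k + 1) +
      1 / (n * (n + 2)) * besselCoeff (n + 4) k = 0 := by
  have : (0 : ℝ) < n := by exact_mod_cast hn
  have hshift₂ : besselCoeff n (k + 1) = -(1 / (2 * n)) * besselCoeff (n + 2) k / (k + 1) := by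
    rw [← succ_mul_besselCoeff hn k]
    field_simp
  have hshift₄ :
      besselCoeff (n + 4) k = -(2 * (n + 2)) * ((k + 1) * besselCoeff (n + 2) (k + 1)) := by
    rw [succ_mul_besselCoeff (n := n + 2) (by omega) k]
    push_cast
    field_simp
  rw [hshift₄, hshift₂, besselCoeff_succ (n + 2) k]
  push_cast
  have : (2 * k + (n + 2) : ℝ) ≠ 0 := by positivity
  field_simp
  ring

theorem abs_besselCoeff_le (hn : 1 ≤ n) (k : ℕ) : |besselCoeff n k| ≤ 1 / (k.factorial : ℝ) := by
  have hn₁ : (1 : ℝ) ≤ n := by exact_mod_cast hn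
  induction k with
  | zero => simp [besselCoeff_zero]
  | succ k ih =>
    have hdenom : (k : ℝ) + 1 ≤ (2 * k + 2) * (2 * k + n) := by nlinarith
    calc |besselCoeff n (k + 1)| = |besselCoeff n k| / ((2 * k + 2) * (2 * k + n)) := by
          rw [besselCoeff_succ, abs_div, abs_neg,
            abs_of_pos ((Nat.cast_add_one_pos k).trans_le hdenom)]
      _ ≤ 1 / k.factorial / (k + 1) := by gcongr
      _ = 1 / (k + 1).factorial := by
          rw [Nat.factorial_succ, div_div, mul_comm, Nat.cast_mul, Nat.cast_succ]

/-- The power series of `φ_n` in the variable `z = r²`. -/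
def besselSeries (n : ℕ) (z : ℝ) : ℝ := ∑' k, besselCoeff n k * z ^ k

theorem summable_besselSeries (hn : 1 ≤ n) (z : ℝ) :
    Summable fun k => besselCoeff n k * z ^ k := by
  refine Summable.of_norm_bounded (Real.summable_pow_div_factorial |z|) fun k => ?_
  calc ‖besselCoeff n k * z ^ k‖ = |besselCoeff n k| * |z| ^ k := by
        rw [Real.norm_eq_abs, abs_mul, abs_pow]
    _ ≤ 1 / (k.factorial : ℝ) * |z| ^ k := by
        gcongr
        exact abs_besselCoeff_le hn k
    _ = |z| ^ k / k.factorial := by ring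

theorem besselSeries_zero (n : ℕ) : besselSeries n 0 = 1 := by
  rw [besselSeries, tsum_eq_single 0]
  · simp [besselCoeff_zero]
  · intro k hk
    simp [hk]

theorem hasSum_mul_besselCoeff_mul_pow_pred (hn : 1 ≤ n) (z : ℝ) :
    HasSum (fun k : ℕ => k * besselCoeff n k * z ^ (k - 1))
      (-(1 / (2 * n)) * besselSeries (n + 2) z) := by
  rw [← hasSum_nat_add_iff' 1]
  have hterm : ∀ k : ℕ, ((k + 1 : ℕ) : ℝ) * besselCoeff n (k + 1) * z ^ (k + 1 - 1) =
      -(1 / (2 * n)) * (besselCoeff (n + 2) k * z ^ k) := by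
    intro k
    rw [Nat.cast_succ, succ_mul_besselCoeff hn, Nat.add_sub_cancel, mul_assoc]
  simp only [hterm, Finset.sum_range_one, Nat.cast_zero, zero_mul, sub_zero]
  exact (summable_besselSeries (by omega) z).hasSum.mul_left _

theorem hasDerivAt_besselSeries (hn : 1 ≤ n) (z : ℝ) :
    HasDerivAt (besselSeries n) (-(1 / (2 * n)) * besselSeries (n + 2) z) z := by
  let r : ℝ := |z| + 1
  have hmajorant : Summable fun k : ℕ => |k * besselCoeff n k * r ^ (k - 1)| :=
    (hasSum_mul_besselCoeff_mul_pow_pred hn r).summable.abs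
  have hterm : ∀ (k : ℕ), ∀ y ∈ Metric.ball (0 : ℝ) r,
      HasDerivAt (fun y => besselCoeff n k * y ^ k) (k * besselCoeff n k * y ^ (k - 1)) y :=
    fun k y _ => ((hasDerivAt_pow k y).const_mul (besselCoeff n k)).congr_deriv (by ring)
  have hbound : ∀ (k : ℕ), ∀ y ∈ Metric.ball (0 : ℝ) r,
      ‖k * besselCoeff n k * y ^ (k - 1)‖ ≤ |k * besselCoeff n k * r ^ (k - 1)| := by
    intro k y hy
    have hyr : |y| ≤ |r| := (mem_ball_zero_iff.1 hy).le.trans (le_abs_self r)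
    rw [Real.norm_eq_abs, abs_mul, abs_mul _ (r ^ (k - 1)), abs_pow, abs_pow]
    gcongr
  rw [← (hasSum_mul_besselCoeff_mul_pow_pred hn z).tsum_eq]
  exact hasDerivAt_tsum_of_isPreconnected hmajorant Metric.isOpen_ball
    (convex_ball 0 r).isPreconnected hterm hbound (Metric.mem_ball_self (by positivity))
    (summable_besselSeries hn 0) (mem_ball_zero_iff.2 (lt_add_one _))

theorem besselSeries_three_term (hn : 1 ≤ n) (z : ℝ) :
    besselSeries n z - besselSeries (n + 2) z +
      z / (n * (n + 2)) * besselSeries (n + 4) z = 0 := by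
  have htail : ∀ {m : ℕ}, 1 ≤ m →
      HasSum (fun k => besselCoeff m (k + 1) * z ^ (k + 1)) (besselSeries m z - 1) := by
    intro m hm
    have h := (hasSum_nat_add_iff' 1).2 (summable_besselSeries hm z).hasSum
    rwa [Finset.sum_range_one, besselCoeff_zero, pow_zero, mul_one] at h
  have hsum := ((htail hn).sub (htail (m := n + 2) (by omega))).add
    ((summable_besselSeries (n := n + 4) (by omega) z).hasSum.mul_left (z / (n * (n + 2))))
  have hzero : ∀ k, besselCoeff n (k + 1) * z ^ (k + 1) - besselCoeff (n + 2) (k + 1) * z ^ (k + 1)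
      + z / (n * (n + 2)) * (besselCoeff (n + 4) k * z ^ k) = 0 := by
    intro k
    linear_combination z ^ (k + 1) * besselCoeff_three_term hn k
  simp only [hzero] at hsum
  have hvalue := hsum.unique hasSum_zero
  rw [sub_sub_sub_cancel_right] at hvalue
  exact hvalue

theorem contDiff_besselSeries (m : ℕ) (hn : 1 ≤ n) : ContDiff ℝ m (besselSeries n) := by
  induction m generalizing n with
  | zero =>
    exact contDiff_zero.2
      (continuous_iff_continuousAt.2 fun z => (hasDerivAt_besselSeries hn z).continuousAt)
  | succ m ih =>
    have hderiv : deriv (besselSeries n) = fun z => -(1 / (2 * n)) * besselSeries (n + 2) z :=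
      funext fun z => (hasDerivAt_besselSeries hn z).deriv
    rw [Nat.cast_succ, contDiff_succ_iff_deriv, hderiv]
    exact ⟨fun z => (hasDerivAt_besselSeries hn z).differentiableAt, by simp,
      contDiff_const.mul (ih (by omega))⟩

theorem hasDerivAt_besselSeries_sq (hn : 1 ≤ n) (r : ℝ) :
    HasDerivAt (fun r => besselSeries n (r ^ 2)) (-(r / n) * besselSeries (n + 2) (r ^ 2)) r := by
  have hn₀ : (n : ℝ) ≠ 0 := by positivity
  refine ((hasDerivAt_besselSeries hn (r ^ 2)).comp r (hasDerivAt_pow 2 r)).congr_deriv ?_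
  field_simp
  norm_num
  ring

theorem isBesselSolution_besselSeries_sq (hn : 1 ≤ n) :
    IsBesselSolution n fun r => besselSeries n (r ^ 2) := by
  have hn₀ : (n : ℝ) ≠ 0 := by positivity
  have hderiv : deriv (fun r => besselSeries n (r ^ 2)) =
      fun r => -(r / n) * besselSeries (n + 2) (r ^ 2) :=
    funext fun r => (hasDerivAt_besselSeries_sq hn r).deriv
  refine ⟨(contDiff_besselSeries 2 hn).comp (contDiff_id.pow 2), fun r hr => ?_, ?_, ?_⟩
  · have hderiv₂ : HasDerivAt (fun r : ℝ => -(r / n) * besselSeries (n + 2) (r ^ 2)) _ r :=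
      (((hasDerivAt_id r).div_const (n : ℝ)).neg).mul
        (hasDerivAt_besselSeries_sq (n := n + 2) (by omega) r)
    rw [hderiv, hderiv₂.deriv]
    have hrel := besselSeries_three_term hn (r ^ 2)
    have : (n : ℝ) + 2 ≠ 0 := by positivity
    simp only [Pi.neg_apply, id]
    push_cast
    field_simp at hrel ⊢
    linear_combination hrel
  · simp [besselSeries_zero]
  · simp [hderiv]

theorem isBesselSolution_besselPhi (hn : 1 ≤ n) : IsBesselSolution n (besselPhi n) := by
  have hex : ∃ f, IsBesselSolution n f := ⟨_, isBesselSolution_besselSeries_sq hn⟩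
  rw [besselPhi, dif_pos hex]
  exact hex.choose_spec

end BesselSeries

namespace IsBesselSolution

variable {n : ℕ} {f : ℝ → ℝ}

theorem differentiable (h : IsBesselSolution n f) : Differentiable ℝ f :=
  h.contDiff.differentiable two_ne_zero

theorem contDiff_deriv (h : IsBesselSolution n f) : ContDiff ℝ 1 (deriv f) :=
  (contDiff_succ_iff_deriv.1 (one_add_one_eq_two (R := WithTop ℕ∞) ▸ h.contDiff)).2.2

theorem differentiable_deriv (h : IsBesselSolution n f) : Differentiable ℝ (deriv f) :=
  h.contDiff_deriv.differentiable one_ne_zero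

theorem continuous_deriv_deriv (h : IsBesselSolution n f) : Continuous (deriv (deriv f)) :=
  h.contDiff_deriv.continuous_deriv le_rfl

theorem hasDerivAt_energy (h : IsBesselSolution n f) {r : ℝ} (hr : r ≠ 0) :
    HasDerivAt (fun r => f r ^ 2 + deriv f r ^ 2) (-(2 * (n - 1) * deriv f r ^ 2) / r) r := by
  refine (((h.differentiable r).hasDerivAt.pow 2).add
    ((h.differentiable_deriv r).hasDerivAt.pow 2)).congr_deriv ?_
  have hode := h.ode r hr
  field_simp at hode ⊢
  linear_combination (2 * deriv f r) * hode

theorem energy_le_one (h : IsBesselSolution n f) (hn : 1 ≤ n) (r : ℝ) :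
    f r ^ 2 + deriv f r ^ 2 ≤ 1 := by
  have hn₁ : (0 : ℝ) ≤ (n : ℝ) - 1 := sub_nonneg.2 (by exact_mod_cast hn)
  have hcont : Continuous fun r => f r ^ 2 + deriv f r ^ 2 :=
    (h.differentiable.continuous.pow 2).add (h.differentiable_deriv.continuous.pow 2)
  have hzero : f 0 ^ 2 + deriv f 0 ^ 2 = 1 := by simp [h.init, h.init_deriv]
  rw [← hzero]
  rcases le_total 0 r with hr | hr
  · refine antitoneOn_of_hasDerivWithinAt_nonpos (convex_Ici 0) hcont.continuousOn
      (fun s hs => (h.hasDerivAt_energy ?_).hasDerivWithinAt) (fun s hs => ?_)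
      Set.self_mem_Ici hr hr
    all_goals rw [interior_Ici, Set.mem_Ioi] at hs
    · exact hs.ne'
    · rw [neg_div]
      exact neg_nonpos.2 (by positivity)
  · refine monotoneOn_of_hasDerivWithinAt_nonneg (convex_Iic 0) hcont.continuousOn
      (fun s hs => (h.hasDerivAt_energy ?_).hasDerivWithinAt) (fun s hs => ?_)
      hr Set.self_mem_Iic hr
    all_goals rw [interior_Iic, Set.mem_Iio] at hs
    · exact hs.ne
    · exact div_nonneg_of_nonpos (neg_nonpos.2 (by positivity)) hs.le

theorem abs_le_one (h : IsBesselSolution n f) (hn : 1 ≤ n) (r : ℝ) : |f r| ≤ 1 :=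
  (sq_le_one_iff_abs_le_one _).1 (by linarith [h.energy_le_one hn r, sq_nonneg (deriv f r)])

theorem abs_deriv_le_one (h : IsBesselSolution n f) (hn : 1 ≤ n) (r : ℝ) : |deriv f r| ≤ 1 :=
  (sq_le_one_iff_abs_le_one _).1 (by linarith [h.energy_le_one hn r, sq_nonneg (f r)])

theorem exists_abs_deriv_deriv_le (h : IsBesselSolution n f) (hn : 1 ≤ n) :
    ∃ C : ℝ, ∀ r, |deriv (deriv f) r| ≤ C := by
  have hn₁ : (0 : ℝ) ≤ (n : ℝ) - 1 := sub_nonneg.2 (by exact_mod_cast hn)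
  obtain ⟨C, hC⟩ := (isCompact_Icc (a := (-1 : ℝ)) (b := 1)).exists_bound_of_continuousOn
    h.continuous_deriv_deriv.continuousOn
  refine ⟨max C n, fun r => ?_⟩
  rcases le_or_gt |r| 1 with hr | hr
  · exact (hC r (abs_le.1 hr)).trans (le_max_left _ _)
  · have hr₀ : r ≠ 0 := abs_pos.1 (zero_lt_one.trans hr)
    have hquot : |deriv f r / r| ≤ 1 := by
      rw [abs_div]
      exact div_le_one_of_le₀ ((h.abs_deriv_le_one hn r).trans hr.le) (abs_nonneg _)
    calc |deriv (deriv f) r| = |((n : ℝ) - 1) * (deriv f r / r) + f r| := by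
          rw [← abs_neg]
          congr 1
          linear_combination -h.ode r hr₀
      _ ≤ ((n : ℝ) - 1) * |deriv f r / r| + |f r| := by
          grw [abs_add_le, abs_mul, abs_of_nonneg hn₁]
      _ ≤ ((n : ℝ) - 1) * 1 + 1 := by
          gcongr
          exact h.abs_le_one hn r
      _ = n := by ring
      _ ≤ max C n := le_max_right _ _

end IsBesselSolution

/-! ### The exterior derivative as a closed operator -/

section ExteriorDerivative

variable {q k : ℕ} {ω : Rn q → AltForm q k} {ψ : Rn q → ℝ} {I : Finset (Fin q)}

theorem formCoeff_zero (k : ℕ) : formCoeff (0 : AltForm q k) = 0 := by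
  ext I
  simp [formCoeff]

theorem formCoeff_apply (α : AltForm q k) (h : I.card = k) :
    formCoeff α I = α fun i => EuclideanSpace.single (I.orderEmbOfFin h i) (1 : ℝ) := by
  simp [formCoeff, h]

theorem formCoeff_apply_of_ne (α : AltForm q k) (h : I.card ≠ k) : formCoeff α I = 0 := by
  simp [formCoeff, h]

theorem contDiff_formCoeff {n : WithTop ℕ∞} (hω : ContDiff ℝ n ω) :
    ContDiff ℝ n fun x => formCoeff (ω x) := by
  rw [contDiff_piLp]
  intro I
  by_cases h : I.card = k
  · simp only [formCoeff_apply _ h]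
    exact (ContinuousAlternatingMap.apply ℝ (Rn q) ℂ _).contDiff.comp hω
  · simpa only [formCoeff_apply_of_ne _ h] using contDiff_const

theorem memLp_formCoeff (hω : Continuous ω) (hs : HasCompactSupport ω) :
    MemLp (fun x => formCoeff (ω x)) 2 (volume : Measure (Rn q)) :=
  (contDiff_zero.1 (contDiff_formCoeff (contDiff_zero.2 hω))).memLp_of_hasCompactSupport
    (hs.comp_left (formCoeff_zero k))

theorem contDiff_extDeriv (hω : ContDiff ℝ (⊤ : ℕ∞) ω) : ContDiff ℝ (⊤ : ℕ∞) (extDeriv ω) :=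
  (ContinuousAlternatingMap.alternatizeUncurryFinCLM ℝ (Rn q) ℂ (n := k)).contDiff.comp
    (hω.fderiv_right (by simp))

theorem hasCompactSupport_extDeriv (hs : HasCompactSupport ω) : HasCompactSupport (extDeriv ω) :=
  (hs.fderiv ℝ).comp_left (map_zero (ContinuousAlternatingMap.alternatizeUncurryFinCLM ℝ (Rn q) ℂ))

section Coordinates

variable {m : ℕ} (h : I.card = m + 1) (j : Fin (m + 1))

theorem card_erase_orderEmbOfFin : (I.erase (I.orderEmbOfFin h j)).card = m := by
  rw [Finset.card_erase_of_mem (Finset.orderEmbOfFin_mem I h j), h, Nat.add_sub_cancel]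

theorem orderEmbOfFin_erase (i : Fin m) :
    (I.erase (I.orderEmbOfFin h j)).orderEmbOfFin (card_erase_orderEmbOfFin h j) i =
      I.orderEmbOfFin h (j.succAbove i) := by
  refine congrFun (Finset.orderEmbOfFin_unique (f := fun i => I.orderEmbOfFin h (j.succAbove i))
    (card_erase_orderEmbOfFin h j) (fun i => ?_) ?_).symm i
  · exact Finset.mem_erase.2 ⟨fun e => Fin.succAbove_ne j i ((I.orderEmbOfFin h).injective e),
      Finset.orderEmbOfFin_mem I h _⟩
  · exact (I.orderEmbOfFin h).strictMono.comp (Fin.strictMono_succAbove j)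

theorem card_filter_lt_orderEmbOfFin : (I.filter (· < I.orderEmbOfFin h j)).card = j := by
  have hfilter : I.filter (· < I.orderEmbOfFin h j) =
      (Finset.Iio j).map (I.orderEmbOfFin h).toEmbedding := by
    ext i
    rw [Finset.mem_filter, ← Finset.mem_coe, ← Finset.range_orderEmbOfFin I h, Finset.mem_map]
    constructor
    · rintro ⟨⟨l, rfl⟩, hl⟩
      exact ⟨l, Finset.mem_Iio.2 ((I.orderEmbOfFin h).lt_iff_lt.1 hl), rfl⟩
    · rintro ⟨l, hl, rfl⟩
      exact ⟨⟨l, rfl⟩, (I.orderEmbOfFin h).lt_iff_lt.2 (Finset.mem_Iio.1 hl)⟩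
  rw [hfilter, Finset.card_map, Fin.card_Iio]

end Coordinates

/-- The sign of `dx_i ∧ dx_{I \ {i}} = ± dx_I`, for `i ∈ I`. -/
def wedgeSign (I : Finset (Fin q)) (i : Fin q) : ℂ :=
  (-1) ^ (I.filter (· < i)).card

theorem formCoeff_extDeriv {x : Rn q} (hω : DifferentiableAt ℝ ω x) (I : Finset (Fin q)) :
    formCoeff (extDeriv ω x) I = ∑ i ∈ I, wedgeSign I i *
      fderiv ℝ (fun x => formCoeff (ω x) (I.erase i)) x (EuclideanSpace.single i 1) := by
  by_cases h : I.card = k + 1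
  · conv_rhs => rw [← Finset.map_orderEmbOfFin_univ I h, Finset.sum_map]
    rw [formCoeff_apply _ h, extDeriv_apply hω]
    refine Finset.sum_congr rfl fun j _ => ?_
    simp only [formCoeff_apply _ (card_erase_orderEmbOfFin h j), orderEmbOfFin_erase,
      RelEmbedding.coe_toEmbedding, wedgeSign, Finset.map_orderEmbOfFin_univ,
      card_filter_lt_orderEmbOfFin, zsmul_eq_mul, Int.cast_pow, Int.cast_neg, Int.cast_one]
    rfl
  · rw [formCoeff_apply_of_ne _ h]
    refine (Finset.sum_eq_zero fun i hi => ?_).symm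
    have herase : (I.erase i).card ≠ k := by
      have := Finset.card_erase_add_one hi
      omega
    simp [formCoeff_apply_of_ne _ herase]

/-- The form `ψ dx_I`, as an element of the Hilbert space of forms. -/
def testForm (hψ : Continuous ψ) (hs : HasCompactSupport ψ) (I : Finset (Fin q)) : FormSpace q :=
  MemLp.toLp (fun x => ψ x • EuclideanSpace.single I (1 : ℂ))
    ((hψ.smul continuous_const).memLp_of_hasCompactSupport hs.smul_right)

theorem coeFn_testForm (hψ : Continuous ψ) (hs : HasCompactSupport ψ) (I : Finset (Fin q)) :
    testForm hψ hs I =ᵐ[volume] fun x => ψ x • EuclideanSpace.single I (1 : ℂ) :=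
  MemLp.coeFn_toLp _

theorem inner_testForm (hψ : Continuous ψ) (hs : HasCompactSupport ψ) (I : Finset (Fin q))
    {y : FormSpace q} {F : Rn q → FormFibre q} (hy : y =ᵐ[volume] F) :
    ⟪testForm hψ hs I, y⟫_ℂ = ∫ x, ψ x • F x I := by
  rw [L2.inner_def]
  refine integral_congr_ae ?_
  filter_upwards [coeFn_testForm hψ hs I, hy] with x hx hyx
  rw [hx, hyx, RCLike.real_smul_eq_coe_smul (K := ℂ), inner_smul_left,
    EuclideanSpace.inner_single_left]
  simp

theorem eq_zero_of_inner_testForm_eq_zero {y : FormSpace q}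
    (h : ∀ (I : Finset (Fin q)) (ψ : Rn q → ℝ) (hψ : ContDiff ℝ (⊤ : ℕ∞) ψ)
      (hs : HasCompactSupport ψ), ⟪testForm hψ.continuous hs I, y⟫_ℂ = 0) : y = 0 := by
  have hcoord : ∀ I : Finset (Fin q), ∀ᵐ x : Rn q, y x I = 0 := by
    refine fun I => ae_eq_zero_of_integral_contDiff_smul_eq_zero ?_ fun ψ hψ hs => ?_
    · exact ((EuclideanSpace.proj (𝕜 := ℂ) I).comp_memLp' (Lp.memLp y)).locallyIntegrable
        one_le_two
    · rw [← inner_testForm hψ.continuous hs I .rfl, h I ψ hψ hs]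
  refine Lp.ext ?_
  filter_upwards [ae_all_iff.2 hcoord, Lp.coeFn_zero (FormFibre q) 2 (volume : Measure (Rn q))]
    with x hx h0
  rw [h0]
  ext I
  exact hx I

theorem integral_smul_formCoeff_extDeriv (hψ : ContDiff ℝ (⊤ : ℕ∞) ψ) (hψs : HasCompactSupport ψ)
    (hω : ContDiff ℝ (⊤ : ℕ∞) ω) (I : Finset (Fin q)) :
    ∫ x, ψ x • formCoeff (extDeriv ω x) I = -∑ i ∈ I, wedgeSign I i *
      ∫ x, fderiv ℝ ψ x (EuclideanSpace.single i 1) • formCoeff (ω x) (I.erase i) := by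
  have hcoeff : ∀ J, ContDiff ℝ (⊤ : ℕ∞) fun x => formCoeff (ω x) J :=
    (contDiff_piLp 2).1 (contDiff_formCoeff hω)
  have hψ' : ∀ v, Continuous fun x => fderiv ℝ ψ x v := fun v =>
    (hψ.continuous_fderiv (by simp)).clm_apply continuous_const
  have hcoeff' : ∀ J v, Continuous fun x => fderiv ℝ (fun x => formCoeff (ω x) J) x v :=
    fun J v => ((hcoeff J).continuous_fderiv (by simp)).clm_apply continuous_const
  have hintegrable : ∀ J v,
      Integrable fun x => ψ x • fderiv ℝ (fun x => formCoeff (ω x) J) x v := fun J v =>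
    (hψ.continuous.smul (hcoeff' J v)).integrable_of_hasCompactSupport hψs.smul_right
  have hparts : ∀ J v, ∫ x, ψ x • fderiv ℝ (fun x => formCoeff (ω x) J) x v =
      -∫ x, fderiv ℝ ψ x v • formCoeff (ω x) J := fun J v =>
    integral_smul_fderiv_eq_neg_fderiv_smul_of_integrable
      (((hψ' v).smul (hcoeff J).continuous).integrable_of_hasCompactSupport
        (hψs.fderiv_apply ℝ v).smul_right)
      (hintegrable J v)
      ((hψ.continuous.smul (hcoeff J).continuous).integrable_of_hasCompactSupport hψs.smul_right)
      (fun x _ => hψ.differentiable (by simp) x) (fun x _ => (hcoeff J).differentiable (by simp) x)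
  simp only [formCoeff_extDeriv (hω.differentiable (by simp) _), Finset.smul_sum,
    ← mul_smul_comm]
  rw [integral_finsetSum _ fun i _ =>
    (hintegrable (I.erase i) (EuclideanSpace.single i 1)).const_mul (wedgeSign I i),
    ← Finset.sum_neg_distrib]
  simp only [integral_const_mul, hparts, mul_neg]

theorem inner_testForm_snd (hψ : ContDiff ℝ (⊤ : ℕ∞) ψ) (hs : HasCompactSupport ψ)
    (I : Finset (Fin q)) {p : FormSpace q × FormSpace q}
    (hp : p ∈ (testGraph q).topologicalClosure) :
    ⟪testForm hψ.continuous hs I, p.2⟫_ℂ = -∑ i ∈ I, wedgeSign I i *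
      ⟪testForm ((hψ.continuous_fderiv (by simp)).clm_apply continuous_const)
        (hs.fderiv_apply ℝ (EuclideanSpace.single i 1)) (I.erase i), p.1⟫_ℂ := by
  let defect : FormSpace q × FormSpace q →L[ℂ] ℂ :=
    (innerSL ℂ (testForm hψ.continuous hs I)).comp (.snd ℂ _ _) +
      ∑ i ∈ I, wedgeSign I i •
        (innerSL ℂ (testForm ((hψ.continuous_fderiv (by simp)).clm_apply continuous_const)
          (hs.fderiv_apply ℝ (EuclideanSpace.single i 1)) (I.erase i))).comp (.fst ℂ _ _)
  have hspan : testGraph q ≤ defect.ker := by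
    refine Submodule.span_le.2 ?_
    rintro p ⟨k, ω, hω, -, hp₁, hp₂⟩
    simp only [SetLike.mem_coe, LinearMap.mem_ker, defect]
    simp [inner_testForm _ _ _ hp₁, inner_testForm _ _ _ hp₂,
      integral_smul_formCoeff_extDeriv hψ hs hω, -Complex.real_smul]
  have hmem : defect p = 0 :=
    Submodule.topologicalClosure_minimal _ hspan defect.isClosed_ker hp
  rw [← sub_eq_zero, sub_neg_eq_add]
  simpa [defect] using hmem

theorem graph_extD : (extD q).graph = (testGraph q).topologicalClosure := by
  refine Submodule.toLinearPMap_graph_eq _ fun p hp hp₁ =>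
    eq_zero_of_inner_testForm_eq_zero fun I ψ hψ hs => ?_
  rw [inner_testForm_snd hψ hs I hp, hp₁]
  simp

theorem mem_graph_extD_zero {x y : FormSpace q} (h : (x, y) ∈ (extD q).graph) :
    (y, (0 : FormSpace q)) ∈ (extD q).graph := by
  rw [graph_extD] at h ⊢
  let T : FormSpace q × FormSpace q →L[ℂ] FormSpace q × FormSpace q :=
    (ContinuousLinearMap.snd ℂ _ _).prod 0
  have hspan : testGraph q ≤ (testGraph q).comap T.toLinearMap := by
    refine Submodule.span_le.2 ?_
    rintro p ⟨k, ω, hω, hs, -, hp₂⟩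
    refine Submodule.subset_span ⟨k + 1, extDeriv ω, contDiff_extDeriv hω,
      hasCompactSupport_extDeriv hs, hp₂, ?_⟩
    rw [extDeriv_extDeriv hω (by
      rw [minSmoothness_of_isRCLikeNormedField]
      exact WithTop.coe_le_coe.2 le_top)]
    filter_upwards [Lp.coeFn_zero (FormFibre q) 2 (volume : Measure (Rn q))] with x hx
    exact hx.trans (formCoeff_zero _).symm
  exact map_mem_closure (f := T) T.continuous h hspan

/-- The alternating form `dx_I`. -/
def basisForm (I : Finset (Fin q)) : AltForm q I.card :=
  let α : Rn q [⋀^Fin I.card]→ₗ[ℝ] ℂ :=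
    Complex.ofRealCLM.toLinearMap.compAlternatingMap
      ((Matrix.detRowAlternating (R := ℝ) (n := Fin I.card)).compLinearMap
        (LinearMap.pi fun b => (EuclideanSpace.proj (𝕜 := ℝ) (I.orderEmbOfFin rfl b)).toLinearMap))
  { α with
    cont := by
      change Continuous fun v : Fin I.card → Rn q =>
        ((Matrix.det (Matrix.of fun a b => v a (I.orderEmbOfFin rfl b)) : ℝ) : ℂ)
      fun_prop }

theorem basisForm_apply (I : Finset (Fin q)) (v : Fin I.card → Rn q) :
    basisForm I v = (Matrix.det (Matrix.of fun a b => v a (I.orderEmbOfFin rfl b)) : ℝ) := rfl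

theorem formCoeff_basisForm (I : Finset (Fin q)) :
    formCoeff (basisForm I) = EuclideanSpace.single I (1 : ℂ) := by
  ext J
  rw [PiLp.single_apply]
  by_cases hcard : J.card = I.card
  · rw [formCoeff_apply _ hcard, basisForm_apply]
    split_ifs with hJI
    · subst hJI
      have hone : (Matrix.of fun a b => (EuclideanSpace.single (J.orderEmbOfFin hcard a)
          (1 : ℝ) : Rn q) (J.orderEmbOfFin rfl b)) = (1 : Matrix (Fin J.card) (Fin J.card) ℝ) := by
        ext a b
        simp [Matrix.one_apply, eq_comm]
      rw [hone, Matrix.det_one, Complex.ofReal_one]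
    · obtain ⟨i, hiJ, hiI⟩ := Finset.not_subset.1 fun hsub : J ⊆ I =>
        hJI (Finset.eq_of_subset_of_card_le hsub hcard.ge)
      obtain ⟨a, ha⟩ : i ∈ Set.range (J.orderEmbOfFin hcard) := by
        rwa [Finset.range_orderEmbOfFin]
      rw [Matrix.det_eq_zero_of_row_eq_zero a fun b => ?_, Complex.ofReal_zero]
      have hne : I.orderEmbOfFin rfl b ≠ i := fun e => hiI (e ▸ Finset.orderEmbOfFin_mem I rfl b)
      simp [ha, hne]
  · rw [formCoeff_apply_of_ne _ hcard, if_neg]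
    rintro rfl
    exact hcard rfl

theorem formCoeff_smul (c : ℝ) (α : AltForm q k) : formCoeff (c • α) = c • formCoeff α := by
  ext I
  by_cases h : I.card = k
  · rw [formCoeff_apply _ h, PiLp.smul_apply, formCoeff_apply _ h]
    rfl
  · rw [formCoeff_apply_of_ne _ h, PiLp.smul_apply, formCoeff_apply_of_ne _ h, smul_zero]

theorem mem_domain_extD_of_ae_eq (hω : ContDiff ℝ (⊤ : ℕ∞) ω) (hs : HasCompactSupport ω)
    {y : FormSpace q} (hy : y =ᵐ[volume] fun x => formCoeff (ω x)) : y ∈ (extD q).domain := by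
  have hd := memLp_formCoeff (contDiff_extDeriv hω).continuous (hasCompactSupport_extDeriv hs)
  have hmem : (y, hd.toLp) ∈ (extD q).graph := by
    rw [graph_extD]
    exact Submodule.le_topologicalClosure _
      (Submodule.subset_span ⟨k, ω, hω, hs, hy, hd.coeFn_toLp⟩)
  exact LinearPMap.mem_domain_of_mem_graph hmem

theorem testForm_mem_domain_extD (hψ : ContDiff ℝ (⊤ : ℕ∞) ψ) (hs : HasCompactSupport ψ)
    (I : Finset (Fin q)) : testForm hψ.continuous hs I ∈ (extD q).domain := by
  have hω : ContDiff ℝ (⊤ : ℕ∞) fun x => ψ x • basisForm I := hψ.smul contDiff_const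
  have hωs : HasCompactSupport fun x => ψ x • basisForm I :=
    hs.comp_left (g := fun r : ℝ => r • basisForm I) (zero_smul ℝ (basisForm I))
  refine mem_domain_extD_of_ae_eq hω hωs ?_
  simpa only [formCoeff_smul, formCoeff_basisForm] using coeFn_testForm hψ.continuous hs I

theorem dense_domain_extD : Dense ((extD q).domain : Set (FormSpace q)) := by
  rw [Submodule.dense_iff_topologicalClosure_eq_top, Submodule.topologicalClosure_eq_top_iff,
    Submodule.eq_bot_iff]
  exact fun y hy => eq_zero_of_inner_testForm_eq_zero fun I ψ hψ hs =>
    (Submodule.mem_orthogonal _ _).1 hy _ (testForm_mem_domain_extD hψ hs I)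

theorem isHilbertComplex_extD : IsHilbertComplex (extD q) where
  isClosed := by
    rw [LinearPMap.IsClosed, graph_extD]
    exact Submodule.isClosed_topologicalClosure _
  dense_domain := dense_domain_extD
  mem_graph_zero := mem_graph_extD_zero

end ExteriorDerivative

/-! ### Bessel curves -/

section Calculus

variable {F : Type*} [NormedAddCommGroup F] [NormedSpace ℝ F] {w : ℝ → F}

theorem deriv_id_smul (hw : Differentiable ℝ w) :
    deriv (fun t => t • w t) = fun t => t • deriv w t + w t := by
  ext t
  simpa using ((hasDerivAt_id t).fun_smul (hw t).hasDerivAt).deriv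

theorem hasDerivAt_deriv_id_smul (hw : Differentiable ℝ w) (hw' : Differentiable ℝ (deriv w))
    (t : ℝ) :
    HasDerivAt (deriv fun t => t • w t) (t • deriv (deriv w) t + (2 : ℝ) • deriv w t) t := by
  rw [deriv_id_smul hw, two_smul, ← add_assoc]
  simpa using ((hasDerivAt_id t).fun_smul (hw' t).hasDerivAt).fun_add (hw t).hasDerivAt

end Calculus

section BesselCurves

variable {H : Type*} [NormedAddCommGroup H] [NormedSpace ℂ H] [NormedSpace ℝ H]

/-- `w` solves `t w'' + (n - 1) w' + t L w = 0` with `w(0) = v` and `w'(0) = 0`. Multiplying the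
radial wave equation by `t` removes the singularity at `t = 0`. -/
structure IsBesselCurve (L : H →ₗ.[ℂ] H) (n : ℕ) (v : H) (w : ℝ → H) : Prop where
  differentiable : Differentiable ℝ w
  differentiable_deriv : Differentiable ℝ (deriv w)
  init : w 0 = v
  init_deriv : deriv w 0 = 0
  exists_mem_graph : ∀ t : ℝ, ∃ z, (w t, z) ∈ L.graph ∧
    t • deriv (deriv w) t + ((n : ℝ) - 1) • deriv w t + t • z = 0

/-- `u` solves `a(u) + L u = 0` for `t > 0`: the form of `SolvesWave` for an arbitrary
operator `L`. -/
def SolvesAbstractWave (L : H →ₗ.[ℂ] H) (a : (ℝ → H) → ℝ → H) (u : ℝ → H) : Prop :=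
  ∀ t : ℝ, 0 < t → DifferentiableAt ℝ u t ∧ DifferentiableAt ℝ (deriv u) t ∧
    ∃ h : u t ∈ L.domain, a u t + L ⟨u t, h⟩ = 0

namespace IsBesselCurve

variable {L : H →ₗ.[ℂ] H} {n : ℕ} {v : H} {w : ℝ → H}

theorem hasDerivAt_zero (hw : IsBesselCurve L n v w) : HasDerivAt w 0 0 :=
  hw.init_deriv ▸ (hw.differentiable 0).hasDerivAt

theorem tendsto_deriv (hw : IsBesselCurve L n v w) : Tendsto (deriv w) (𝓝[≠] 0) (𝓝 0) := by
  have hcont := (hw.differentiable_deriv 0).continuousAt.tendsto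
  rw [hw.init_deriv] at hcont
  exact hcont.mono_left nhdsWithin_le_nhds

theorem solvesAbstractWave (hw : IsBesselCurve L n v w) :
    SolvesAbstractWave L
      (fun u t => deriv (deriv u) t + ((n : ℝ) - 1) • ((1 / t) • deriv u t)) w := by
  intro t ht
  obtain ⟨z, hz, hode⟩ := hw.exists_mem_graph t
  obtain ⟨y, hy, hLy⟩ := (LinearPMap.mem_graph_iff _).1 hz
  obtain ⟨y, hyL⟩ := y
  obtain rfl : y = w t := hy
  refine ⟨hw.differentiable t, hw.differentiable_deriv t, hyL, ?_⟩
  rw [hLy, ← smul_zero t⁻¹, ← hode]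
  match_scalars <;> field_simp

theorem hasDerivAt_smul_zero (hw : IsBesselCurve L n v w) :
    HasDerivAt (fun t => t • w t) v 0 := by
  have hderiv := (differentiable_id.fun_smul hw.differentiable 0).hasDerivAt
  simpa [deriv_id_smul hw.differentiable, hw.init] using hderiv

theorem tendsto_deriv_smul (hw : IsBesselCurve L n v w) :
    Tendsto (deriv fun t => t • w t) (𝓝[≠] 0) (𝓝 v) := by
  have hcont := (hasDerivAt_deriv_id_smul hw.differentiable
    hw.differentiable_deriv 0).continuousAt.tendsto
  rw [hw.hasDerivAt_smul_zero.deriv] at hcont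
  exact hcont.mono_left nhdsWithin_le_nhds

theorem solvesAbstractWave_smul [IsScalarTower ℝ ℂ H] (hw : IsBesselCurve L (n + 2) v w) :
    SolvesAbstractWave L (fun u t => deriv (deriv u) t +
      ((n : ℝ) - 1) • ((1 / t) • deriv u t - (1 / t ^ 2) • u t)) fun t => t • w t := by
  intro t ht
  obtain ⟨z, hz, hode⟩ := hw.exists_mem_graph t
  have htz : (t • w t, t • z) ∈ L.graph := by
    simpa only [Prod.smul_mk, algebraMap_smul] using
      Submodule.smul_mem _ (algebraMap ℝ ℂ t) hz
  obtain ⟨y, hy, hLy⟩ := (LinearPMap.mem_graph_iff _).1 htz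
  obtain ⟨y, hyL⟩ := y
  obtain rfl : y = t • w t := hy
  have hu' := hasDerivAt_deriv_id_smul hw.differentiable hw.differentiable_deriv t
  refine ⟨differentiable_id.fun_smul hw.differentiable t, hu'.differentiableAt, hyL, ?_⟩
  change deriv (deriv fun t => t • w t) t + _ + _ = _
  rw [hLy, hu'.deriv, deriv_id_smul hw.differentiable, ← hode]
  push_cast
  match_scalars <;> field_simp <;> ring

end IsBesselCurve

end BesselCurves

/-! ### Bessel functions of a self-adjoint operator -/

namespace SpectralRep

variable {𝒜 X H : Type*} [AddCommGroup 𝒜] [Module ℂ 𝒜] [MeasurableSpace X]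
  [NormedAddCommGroup H] [InnerProductSpace ℂ H] [CompleteSpace H] [NormedSpace ℝ H]
  [IsScalarTower ℝ ℂ H] {S : SpectralRep 𝒜 X H}

theorem hasDerivAt_vec {x : H} {G : ℝ → X → ℂ} {g b : X → ℂ} {t₀ : ℝ}
    (hb : MemLp b 2 (S.meas x)) (hG : ∀ t, Measurable (G t)) (hGm : ∀ t, MemLp (G t) 2 (S.meas x))
    (hg : Measurable g) (hderiv : ∀ s, HasDerivAt (fun t => G t s) (g s) t₀)
    (hlip : ∀ t s, ‖G t s - G t₀ s‖ ≤ ‖b s‖ * |t - t₀|) :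
    HasDerivAt (fun t => S.vec x (G t)) (S.vec x g) t₀ := by
  have hslope : ∀ t, slope (fun t => S.vec x (G t)) t₀ t =
      S.vec x (((t - t₀)⁻¹ : ℂ) • (G t - G t₀)) := by
    intro t
    rw [vec_const_smul _ ((hGm t).sub (hGm t₀)), vec_sub (hGm t) (hGm t₀), slope_def_module,
      ← algebraMap_smul ℂ (t - t₀)⁻¹]
    simp
  have hlim : ∀ s, Tendsto (fun t : ℝ => (((t - t₀)⁻¹ : ℂ) • (G t - G t₀)) s) (𝓝[≠] t₀)
      (𝓝 (g s)) := by
    refine fun s => (hasDerivAt_iff_tendsto_slope.1 (hderiv s)).congr fun t => ?_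
    rw [slope_def_module, Complex.real_smul]
    push_cast
    rfl
  have hbound : ∀ (t : ℝ) s, ‖(((t - t₀)⁻¹ : ℂ) • (G t - G t₀)) s‖ ≤ ‖b s‖ := by
    intro t s
    rw [Pi.smul_apply, Pi.sub_apply, norm_smul, norm_inv, ← Complex.ofReal_sub, Complex.norm_real,
      Real.norm_eq_abs, inv_mul_eq_div]
    exact div_le_of_le_mul₀ (abs_nonneg _) (norm_nonneg _) (hlip t s)
  rw [hasDerivAt_iff_tendsto_slope, funext hslope]
  exact tendsto_vec_of_dominated hb (fun t => ((hG t).sub (hG t₀)).const_smul _) hg hbound hlim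

end SpectralRep

section FunctionalCalculus

variable {H : Type*} [NormedAddCommGroup H] [InnerProductSpace ℂ H] [CompleteSpace H]

namespace PVM

variable {E : PVM H} {A : H →ₗ.[ℂ] H} {x : H} {k : ℕ} {h : ℝ → ℝ} {C : ℝ}

variable (E) in
/-- The vector `A ^ k h(t A) x`, where `E` is the spectral measure of `A`. -/
def dilate (x : H) (k : ℕ) (h : ℝ → ℝ) (t : ℝ) : H :=
  E.rep.vec x fun s => (s ^ k * h (t * s) : ℝ)

theorem measurable_dilation (k : ℕ) (hh : Measurable h) (t : ℝ) :
    Measurable fun s : ℝ => ((s ^ k * h (t * s) : ℝ) : ℂ) :=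
  Complex.measurable_ofReal.comp
    ((measurable_id.pow_const k).mul (hh.comp (measurable_const_mul t)))

theorem memLp_dilation (hk : MemLp (fun s : ℝ => ((s ^ k : ℝ) : ℂ)) 2 (E.rep.meas x))
    (hh : Measurable h) (hC : ∀ r, |h r| ≤ C) (t : ℝ) :
    MemLp (fun s : ℝ => ((s ^ k * h (t * s) : ℝ) : ℂ)) 2 (E.rep.meas x) := by
  refine MemLp.of_le_mul hk (measurable_dilation k hh t).aestronglyMeasurable
    (.of_forall fun s => ?_) (c := C)
  rw [Complex.norm_real, Complex.norm_real, norm_mul, mul_comm]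
  exact mul_le_mul_of_nonneg_right (hC _) (norm_nonneg _)

theorem memLp_pow_of_le {j : ℕ} (hjk : j ≤ k)
    (hk : MemLp (fun s : ℝ => ((s ^ k : ℝ) : ℂ)) 2 (E.rep.meas x)) :
    MemLp (fun s : ℝ => ((s ^ j : ℝ) : ℂ)) 2 (E.rep.meas x) := by
  refine ((memLp_const (1 : ℝ)).add hk.norm).mono
    (Complex.measurable_ofReal.comp (measurable_id.pow_const j)).aestronglyMeasurable
    (.of_forall fun s => ?_)
  have hpow : |s| ^ j ≤ 1 + |s| ^ k := by
    rcases le_total |s| 1 with hs | hs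
    · exact (pow_le_one₀ (abs_nonneg s) hs).trans (le_add_of_nonneg_right (by positivity))
    · exact (pow_le_pow_right₀ hs hjk).trans (le_add_of_nonneg_left zero_le_one)
  simpa [abs_of_nonneg (show 0 ≤ 1 + |s| ^ k by positivity)] using hpow

theorem hasDerivAt_dilate [NormedSpace ℝ H] [IsScalarTower ℝ ℂ H]
    (hk : MemLp (fun s : ℝ => ((s ^ (k + 1) : ℝ) : ℂ)) 2 (E.rep.meas x))
    (hh : Differentiable ℝ h) {C' : ℝ} (hC : ∀ r, |h r| ≤ C) (hC' : ∀ r, |deriv h r| ≤ C') (t : ℝ) :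
    HasDerivAt (E.dilate x k h) (E.dilate x (k + 1) (deriv h) t) t := by
  have hlip : ∀ r r', |h r - h r'| ≤ C' * |r - r'| := fun r r' =>
    Convex.norm_image_sub_le_of_norm_deriv_le (s := Set.univ) (fun r _ => hh r)
      (fun r _ => hC' r) convex_univ (Set.mem_univ r') (Set.mem_univ r)
  refine SpectralRep.hasDerivAt_vec (hk.const_smul (C' : ℂ))
    (measurable_dilation k hh.continuous.measurable)
    (memLp_dilation (memLp_pow_of_le k.le_succ hk) hh.continuous.measurable hC)
    (measurable_dilation (k + 1) (measurable_deriv h) t) (fun s => ?_) fun t' s => ?_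
  · refine ((((hh (t * s)).hasDerivAt.comp t (hasDerivAt_mul_const s)).const_mul
      (s ^ k)).congr_deriv ?_).ofReal_comp
    ring
  · have hC'₀ : 0 ≤ C' := (abs_nonneg _).trans (hC' 0)
    have hfactor : s ^ k * h (t' * s) - s ^ k * h (t * s) =
        s ^ k * (h (t' * s) - h (t * s)) := by ring
    have hincrement : t' * s - t * s = s * (t' - t) := by ring
    rw [← Complex.ofReal_sub, hfactor, Pi.smul_apply, norm_smul, Complex.norm_real,
      Complex.norm_real, Complex.norm_real, norm_mul, Real.norm_of_nonneg hC'₀]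
    calc ‖s ^ k‖ * ‖h (t' * s) - h (t * s)‖ ≤ ‖s ^ k‖ * (C' * |s * (t' - t)|) := by
          rw [← hincrement]
          exact mul_le_mul_of_nonneg_left (hlip _ _) (norm_nonneg _)
      _ = C' * ‖s ^ (k + 1)‖ * |t' - t| := by
          rw [abs_mul, pow_succ, norm_mul, Real.norm_eq_abs s]
          ring

theorem dilate_zero_zero (hh : h 0 = 1) : E.dilate x 0 h 0 = x := by
  have hone : (fun s : ℝ => ((s ^ 0 * h (0 * s) : ℝ) : ℂ)) = 1 := by
    ext s
    simp [hh]
  rw [dilate, hone, SpectralRep.vec_one]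

theorem dilate_zero_right (hh : h 0 = 0) : E.dilate x k h 0 = 0 := by
  have hzero : (fun s : ℝ => ((s ^ k * h (0 * s) : ℝ) : ℂ)) = 0 := by
    ext s
    simp [hh]
  rw [dilate, hzero, SpectralRep.vec_zero]

theorem integral_dilation (hh : Measurable h) (hC : ∀ r, |h r| ≤ C) (t : ℝ) :
    E.integral (fun s => h (t * s)) x = E.dilate x 0 h t := by
  have hdilate : E.dilate x 0 h t = E.rep.vec x fun s => (h (t * s) : ℂ) := by
    simp only [dilate, pow_zero, one_mul]
  rw [hdilate]
  exact E.integral_apply (hh.comp (measurable_const_mul t)) (fun s => hC (t * s)) x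

theorem dilate_mem_graph (hE : E.IsResolutionOf A) (hA : Dense (A.domain : Set H))
    (hk : MemLp (fun s : ℝ => ((s ^ (k + 1) : ℝ) : ℂ)) 2 (E.rep.meas x)) (hh : Measurable h)
    (hC : ∀ r, |h r| ≤ C) (t : ℝ) :
    (E.dilate x k h t, E.dilate x (k + 1) h t) ∈ A.graph := by
  have hmul : (fun s : ℝ => ((s ^ (k + 1) * h (t * s) : ℝ) : ℂ)) =
      fun s : ℝ => (s : ℂ) * ((s ^ k * h (t * s) : ℝ) : ℂ) := by
    ext s
    push_cast
    ring
  have hmem := memLp_dilation hk hh hC t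
  rw [dilate, dilate, hmul]
  rw [hmul] at hmem
  exact hE.vec_mem_graph hA (measurable_dilation k hh t)
    (memLp_dilation (memLp_pow_of_le k.le_succ hk) hh hC t) hmem

theorem memLp_sq_of_mem_domain (hE : E.IsResolutionOf A) (hA : Dense (A.domain : Set H))
    (hx : x ∈ (opMul A A).domain) :
    MemLp (fun s : ℝ => ((s ^ 2 : ℝ) : ℂ)) 2 (E.rep.meas x) := by
  obtain ⟨y, hxy, hyz⟩ := mem_graph_opMul_iff.1 ((opMul A A).mem_graph ⟨x, hx⟩)
  obtain ⟨hx₁, rfl⟩ := (hE.mem_graph_iff hA).1 hxy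
  have hid : Measurable fun s : ℝ => (s : ℂ) := Complex.measurable_ofReal
  refine ((SpectralRep.memLp_vec_iff hid hid hx₁).1 ((hE.mem_graph_iff hA).1 hyz).1).congr_norm
    (Complex.measurable_ofReal.comp (measurable_id.pow_const 2)).aestronglyMeasurable
    (.of_forall fun s => ?_)
  simp [sq]

theorem dilate_ode [NormedSpace ℝ H] [IsScalarTower ℝ ℂ H] {n : ℕ} {φ : ℝ → ℝ} {C₀ C₁ C₂ : ℝ}
    (hφ : IsBesselSolution n φ) (hC₀ : ∀ r, |φ r| ≤ C₀) (hC₁ : ∀ r, |deriv φ r| ≤ C₁)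
    (hC₂ : ∀ r, |deriv (deriv φ) r| ≤ C₂)
    (hx : MemLp (fun s : ℝ => ((s ^ 2 : ℝ) : ℂ)) 2 (E.rep.meas x)) (t : ℝ) :
    t • E.dilate x 2 (deriv (deriv φ)) t + ((n : ℝ) - 1) • E.dilate x 1 (deriv φ) t +
      t • E.dilate x 2 φ t = 0 := by
  have hode : ∀ s, t * (s ^ 2 * deriv (deriv φ) (t * s)) +
      ((n : ℝ) - 1) * (s ^ 1 * deriv φ (t * s)) + t * (s ^ 2 * φ (t * s)) = 0 := by
    intro s
    rcases eq_or_ne t 0 with rfl | ht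
    · simp [hφ.init_deriv]
    rcases eq_or_ne s 0 with rfl | hs
    · simp
    have hode := hφ.ode (t * s) (mul_ne_zero ht hs)
    field_simp at hode
    linear_combination s * hode
  have hsymbol : (t : ℂ) • (fun s => ((s ^ 2 * deriv (deriv φ) (t * s) : ℝ) : ℂ)) +
      (((n : ℝ) - 1 : ℝ) : ℂ) • (fun s => ((s ^ 1 * deriv φ (t * s) : ℝ) : ℂ)) +
      (t : ℂ) • (fun s => ((s ^ 2 * φ (t * s) : ℝ) : ℂ)) = 0 := by
    ext s
    simpa only [Complex.ofReal_add, Complex.ofReal_mul, Complex.ofReal_zero, Pi.add_apply,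
      Pi.smul_apply, smul_eq_mul, Pi.zero_apply] using
      congrArg Complex.ofReal (hode s)
  have hφ'' := memLp_dilation hx (measurable_deriv (deriv φ)) hC₂ t
  have hφ' := memLp_dilation (memLp_pow_of_le one_le_two hx) (measurable_deriv φ) hC₁ t
  have hφ₀ := memLp_dilation hx hφ.contDiff.continuous.measurable hC₀ t
  simp only [← algebraMap_smul ℂ t, ← algebraMap_smul ℂ ((n : ℝ) - 1), Complex.coe_algebraMap,
    dilate]
  rw [← SpectralRep.vec_const_smul _ hφ'', ← SpectralRep.vec_const_smul _ hφ',
    ← SpectralRep.vec_const_smul _ hφ₀,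
    ← SpectralRep.vec_add (hφ''.const_smul _) (hφ'.const_smul _),
    ← SpectralRep.vec_add ((hφ''.const_smul _).add (hφ'.const_smul _)) (hφ₀.const_smul _),
    hsymbol, SpectralRep.vec_zero]

end PVM

variable [NormedSpace ℝ H] [IsScalarTower ℝ ℂ H]

theorem IsBesselSolution.isBesselCurve {n : ℕ} {φ : ℝ → ℝ} (hφ : IsBesselSolution n φ)
    (hn : 1 ≤ n) {A : H →ₗ.[ℂ] H} {E : PVM H} (hE : E.IsResolutionOf A)
    (hA : Dense (A.domain : Set H)) {v : H} (hv : v ∈ (opMul A A).domain) :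
    IsBesselCurve (opMul A A) n v fun t => E.integral (fun s => φ (t * s)) v := by
  obtain ⟨C, hC⟩ := hφ.exists_abs_deriv_deriv_le hn
  have hC₀ := hφ.abs_le_one hn
  have hC₁ := hφ.abs_deriv_le_one hn
  have hmeas : Measurable φ := hφ.contDiff.continuous.measurable
  have hv₂ := PVM.memLp_sq_of_mem_domain hE hA hv
  have hv₁ := PVM.memLp_pow_of_le one_le_two hv₂
  have hw : (fun t => E.integral (fun s => φ (t * s)) v) = E.dilate v 0 φ :=
    funext (PVM.integral_dilation hmeas hC₀)
  have hw' : ∀ t, HasDerivAt (E.dilate v 0 φ) (E.dilate v 1 (deriv φ) t) t :=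
    PVM.hasDerivAt_dilate hv₁ hφ.differentiable hC₀ hC₁
  have hw'' : ∀ t, HasDerivAt (E.dilate v 1 (deriv φ)) (E.dilate v 2 (deriv (deriv φ)) t) t :=
    PVM.hasDerivAt_dilate hv₂ hφ.differentiable_deriv hC₁ hC
  have hderiv : deriv (E.dilate v 0 φ) = E.dilate v 1 (deriv φ) := funext fun t => (hw' t).deriv
  rw [hw]
  refine ⟨fun t => (hw' t).differentiableAt, ?_, PVM.dilate_zero_zero hφ.init, ?_, fun t => ?_⟩
  · exact hderiv ▸ fun t => (hw'' t).differentiableAt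
  · rw [hderiv, PVM.dilate_zero_right hφ.init_deriv]
  · refine ⟨E.dilate v 2 φ t, mem_graph_opMul_iff.2 ⟨E.dilate v 1 φ t, ?_, ?_⟩, ?_⟩
    · exact PVM.dilate_mem_graph hE hA hv₁ hmeas hC₀ t
    · exact PVM.dilate_mem_graph hE hA hv₂ hmeas hC₀ t
    · rw [hderiv, (hw'' t).deriv]
      exact PVM.dilate_ode hφ hC₀ hC₁ hC hv₂ t

theorem IsHilbertComplex.isBesselCurve_funCalc {d : H →ₗ.[ℂ] H} (hd : IsHilbertComplex d) {n : ℕ}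
    (hn : 1 ≤ n) {v : H} (hv : v ∈ (opMul d† d + opMul d d†).domain) :
    IsBesselCurve (opMul d† d + opMul d d†) n v
      fun t => funCalc (d + d†) (fun s => besselPhi n (t * s)) v := by
  obtain ⟨E, hE, hfunCalc⟩ := funCalc_eq hd.exists_isResolutionOf_dirac
  rw [hd.laplacian_eq_opMul_dirac] at hv ⊢
  simp only [hfunCalc]
  exact (isBesselSolution_besselPhi hn).isBesselCurve hn hE hd.dense_domain_dirac hv

theorem theorem1_general {d : H →ₗ.[ℂ] H} (hd : IsHilbertComplex d) {n : ℕ} (hn : 1 ≤ n) {v : H}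
    (hv : v ∈ (opMul d† d + opMul d d†).domain) :
    let φ : ℕ → ℝ → H →L[ℂ] H := fun m t => funCalc (d + d†) fun s => besselPhi m (t * s)
    (SolvesAbstractWave (opMul d† d + opMul d d†)
        (fun u t => deriv (deriv u) t +
          ((n : ℝ) - 1) • ((1 / t) • deriv u t - (1 / t ^ 2) • u t))
        (fun t => t • φ (n + 2) t v) ∧
      (0 : ℝ) • φ (n + 2) 0 v = 0 ∧
      HasDerivAt (fun t => t • φ (n + 2) t v) v 0 ∧
      Tendsto (deriv fun t => t • φ (n + 2) t v) (𝓝[≠] 0) (𝓝 v)) ∧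
    (SolvesAbstractWave (opMul d† d + opMul d d†)
        (fun u t => deriv (deriv u) t + ((n : ℝ) - 1) • ((1 / t) • deriv u t))
        (fun t => φ n t v) ∧
      φ n 0 v = v ∧
      HasDerivAt (fun t => φ n t v) 0 0 ∧
      Tendsto (deriv fun t => φ n t v) (𝓝[≠] 0) (𝓝 0)) := by
  have hodd := hd.isBesselCurve_funCalc (Nat.le_add_left 1 (n + 1)) hv
  have heven := hd.isBesselCurve_funCalc hn hv
  exact ⟨⟨hodd.solvesAbstractWave_smul, zero_smul ℝ _, hodd.hasDerivAt_smul_zero,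
    hodd.tendsto_deriv_smul⟩,
    heven.solvesAbstractWave, heven.init, heven.hasDerivAt_zero, heven.tendsto_deriv⟩

end FunctionalCalculus

end

theorem theorem1 (q : ℕ) (hq : 1 ≤ q) (f : (extD q).domain)
    (hf : extD q f ∈ (hodgeLaplacian q).domain) :
    (SolvesWave q (besselAccelOne q) (fun t => deformedExtD q t f) ∧
      deformedExtD q 0 f = 0 ∧
      HasDerivAt (fun t => deformedExtD q t f) (extD q f) 0 ∧
      Tendsto (deriv fun t => deformedExtD q t f) (𝓝[≠] 0) (𝓝 (extD q f))) ∧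
    (SolvesWave q (besselAccelZero q) (fun t => phiDirac q q t (extD q f)) ∧
      phiDirac q q 0 (extD q f) = extD q f ∧
      HasDerivAt (fun t => phiDirac q q t (extD q f)) 0 0 ∧
      Tendsto (deriv fun t => phiDirac q q t (extD q f)) (𝓝[≠] 0) (𝓝 0)) :=
  theorem1_general isHilbertComplex_extD hq hf
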